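/- Let $\gamma_L,\gamma_R,\alpha_L,\alpha_R,b\in\mathbb R$ satisfy $|\gamma_L|>1$, $|\gamma_R|>1$ and $\alpha_L>0>\alpha_R$, and consider the planar piecewise linear system (with a node in each half plane) $$ (x',y')=\begin{cases}F^-(x,y)=\bigl(2\gamma_L x-y,\ (\gamma_L^2-1)x-\alpha_L\bigr), & x<0,\\[2pt] F^+(x,y)=\bigl(2\gamma_R x-y+b,\ (\gamma_R^2-1)x-\alpha_R\bigr), & x>0.\end{cases} $$ A point $(0,y)$ is a crossing point if the first components of $F^-(0,y)$ and $F^+(0,y)$ are nonzero and have the same sign; there the orbit arriving from one half plane is continued by the orbit that enters the other one. A crossing periodic orbit is the orbit of a nonconstant periodic solution that meets the line $x=0$ only at crossing points. A limit cycle is a crossing periodic orbit $\Gamma$ that is isolated, i.e. some neighbourhood of $\Gamma$ contains no other crossing periodic orbit. If $\gamma_L>0>\gamma_R$, $b>0$ and $\gamma_L+\gamma_R>0$, then the system has at most two limit cycles. -/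

import Mathlib

namespace NodeNode

/-- The five real parameters of the planar piecewise linear system. -/
structure Params where
  γL : ℝ
  γR : ℝ
  αL : ℝ
  αR : ℝ
  b : ℝ

/-- Both subsystems are nodes with two different eigenvalues `γ - 1` and `γ + 1`,
and `αL > 0 > αR`. -/
def Params.Admissible (p : Params) : Prop :=
  1 < |p.γL| ∧ 1 < |p.γR| ∧ 0 < p.αL ∧ p.αR < 0

/-- The left vector field, in force for `x < 0`:
`x' = 2 γL x - y`, `y' = (γL ^ 2 - 1) x - αL`. -/
def leftField (p : Params) (q : ℝ × ℝ) : ℝ × ℝ :=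
  (2 * p.γL * q.1 - q.2, (p.γL ^ 2 - 1) * q.1 - p.αL)

/-- The right vector field, in force for `x > 0`:
`x' = 2 γR x - y + b`, `y' = (γR ^ 2 - 1) x - αR`. -/
def rightField (p : Params) (q : ℝ × ℝ) : ℝ × ℝ :=
  (2 * p.γR * q.1 - q.2 + p.b, (p.γR ^ 2 - 1) * q.1 - p.αR)

/-- `z` is a complete solution of the piecewise linear system that meets the switching line `x = 0`
only at crossing points, that is, at points where the first components of both vector fields are
nonzero of the same sign. Off the line it solves the differential equation of its zone; at a
crossing point the arriving orbit of one zone is concatenated with the departing orbit of the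
other zone (the Filippov convention on the crossing set). -/
structure IsCrossingSolution (p : Params) (z : ℝ → ℝ × ℝ) : Prop where
  left : ∀ t, (z t).1 < 0 → HasDerivAt z (leftField p (z t)) t
  right : ∀ t, 0 < (z t).1 → HasDerivAt z (rightField p (z t)) t
  switch : ∀ t, (z t).1 = 0 →
    -- from the right zone to the left zone
    ((leftField p (z t)).1 < 0 ∧ (rightField p (z t)).1 < 0 ∧
      HasDerivWithinAt z (rightField p (z t)) (Set.Iic t) t ∧
      HasDerivWithinAt z (leftField p (z t)) (Set.Ici t) t) ∨
    -- from the left zone to the right zone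
    (0 < (leftField p (z t)).1 ∧ 0 < (rightField p (z t)).1 ∧
      HasDerivWithinAt z (leftField p (z t)) (Set.Iic t) t ∧
      HasDerivWithinAt z (rightField p (z t)) (Set.Ici t) t)

/-- `Γ` is a crossing periodic orbit: the trace in the plane of a nonconstant periodic crossing
solution. -/
def IsCrossingPeriodicOrbit (p : Params) (Γ : Set (ℝ × ℝ)) : Prop :=
  ∃ z : ℝ → ℝ × ℝ, IsCrossingSolution p z ∧ (∃ T : ℝ, 0 < T ∧ Function.Periodic z T) ∧
    (∃ s t : ℝ, z s ≠ z t) ∧ Γ = Set.range z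

/-- `Γ` is a (crossing) limit cycle: a crossing periodic orbit that is isolated, i.e. it has a
neighbourhood that contains no other crossing periodic orbit. -/
def IsLimitCycle (p : Params) (Γ : Set (ℝ × ℝ)) : Prop :=
  IsCrossingPeriodicOrbit p Γ ∧
    ∃ U : Set (ℝ × ℝ), IsOpen U ∧ Γ ⊆ U ∧
      ∀ Γ' : Set (ℝ × ℝ), IsCrossingPeriodicOrbit p Γ' → Γ' ⊆ U → Γ' = Γ

end NodeNode

/-! There is in fact at most one crossing periodic orbit. In each zone the eigencoordinates of the
node evolve by factors `exp (r * s)`. On the line `x = 0` a left flight of time `s` therefore has a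
determined start `y₀` and end `-y₁` (`halfStart`, `halfEnd`). The right flight, run backwards, has
the same form in `y₀ - b` and `y₁ + b`. The return map is increasing, so a periodic orbit closes
after one turn (`exists_closed_turn`) and gives an `s` at which the left half map meets the shifted
right one.

Such an `s` is unique (`half_flights_not_lt`). Along the left curve, let `E` be the first integral
of the right node at `y₀ - b` minus its value at `-(y₁ + b)`. `E` is negative for small `s` and
vanishes at each match, and `E'` has the sign of `Ψ`, a positive multiple of right slope minus left
slope. If `Ψ` increases through each zero with `y₀ > b`, then once `E` has risen to `0` it cannot
return there.

That sign of `Ψ'` compares curvatures at a common slope (`tangency_curvature`). In the normalized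
coordinates of `normalized_half_map` both sides satisfy `c (θ + δ τ)² = (1 - δ²)(1 - τ²)` with `c =
1 - 1/γ²` and the same `θ`. The shift `b > 0` makes `δ` larger on the right, `γL + γR > 0` makes `c`
no larger there, and `curvature_comparison` turns this into the inequality. -/

/-! ### Curvature comparison at a common slope -/

namespace NodeNode

/-- Sign of the logarithmic derivative used in `slope_ratio_strictAntiOn`. -/
lemma slope_ratio_ineq {Q θ x : ℝ} (hx0 : 0 < x) (hx1 : x < 1) (hQ : 0 < Q) (hθ : θ < 1)
    (hQx : Q * x < 1 + x) (hE : 0 < 2 * Q * x - 1 + x ^ 2) (hN : 0 < 1 - x ^ 2 + Q * (θ - x)) :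
    (Q * x - 1) * (1 - x ^ 2) * (1 - x ^ 2 + Q * (θ - x))
      < Q * x * (1 + x ^ 2 - 2 * x * θ) * (2 * Q * x - 1 + x ^ 2) := by
  have hx2 : 0 < 1 - x ^ 2 := by nlinarith
  have hu : 0 < Q * x := mul_pos hQ hx0
  have hpos : 0 < 1 + x ^ 2 - 2 * x * θ := by nlinarith [sq_nonneg (1 - x)]
  have hR : 0 < Q * x * (1 + x ^ 2 - 2 * x * θ) * (2 * Q * x - 1 + x ^ 2) := by positivity
  rcases le_or_gt (Q * x) 1 with h | h
  · have : (Q * x - 1) * (1 - x ^ 2) * (1 - x ^ 2 + Q * (θ - x)) ≤ 0 := by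
      have : 0 ≤ (1 - Q * x) * ((1 - x ^ 2) * (1 - x ^ 2 + Q * (θ - x))) :=
        mul_nonneg (by linarith) (by positivity)
      linarith
    linarith
  · set u := Q * x with hudef
    have h1 : 0 < (1 - θ) * ((u - 1) * (1 - x ^ 2) * Q + 2 * x * u * (2 * Q * x - 1 + x ^ 2)) := by
      apply mul_pos (by linarith)
      have : 0 < u - 1 := by linarith
      positivity
    have h2 : 0 < (1 - x) ^ 2 * ((1 + x - u) * ((1 - x) * u + x * (1 + x))) := by
      have : 0 < 1 - x := by linarith
      have : 0 < 1 + x - u := by linarith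
      positivity
    -- Multiplied by `x`, the difference splits into a term carrying `1 - θ` and a term carrying `1
    -- + x - Q * x`, both positive.
    have h3 : x * (u * (1 + x ^ 2 - 2 * x * θ) * (2 * Q * x - 1 + x ^ 2) -
        (u - 1) * (1 - x ^ 2) * (1 - x ^ 2 + Q * (θ - x))) =
        x * ((1 - θ) * ((u - 1) * (1 - x ^ 2) * Q + 2 * x * u * (2 * Q * x - 1 + x ^ 2)))
        + (1 - x) ^ 2 * ((1 + x - u) * ((1 - x) * u + x * (1 + x))) := by
      rw [hudef]; ring
    have h4 : 0 < x * (u * (1 + x ^ 2 - 2 * x * θ) * (2 * Q * x - 1 + x ^ 2) -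
        (u - 1) * (1 - x ^ 2) * (1 - x ^ 2 + Q * (θ - x))) := by
      rw [h3]; positivity
    have := (mul_pos_iff_of_pos_left hx0).1 h4
    linarith

/-- Strict monotonicity of the squared slope ratio along curves of constant `Q`. -/
lemma slope_ratio_lt {Q θ x₁ x₂ : ℝ} (hx0 : 0 < x₁) (hx : x₁ < x₂) (hx1 : x₂ < 1) (hQ : 0 < Q)
    (hθ : θ < 1) (hQx : Q * x₂ < 1 + x₂) (hE : 0 < 2 * Q * x₁ - 1 + x₁ ^ 2)
    (hN : 0 < 1 - x₂ ^ 2 + Q * (θ - x₂)) :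
    (x₂ * (1 - x₂ ^ 2 + Q * (θ - x₂))) ^ 2 / ((1 - x₂ ^ 2) ^ 2 * (2 * Q * x₂ - 1 + x₂ ^ 2))
      < (x₁ * (1 - x₁ ^ 2 + Q * (θ - x₁))) ^ 2 /
        ((1 - x₁ ^ 2) ^ 2 * (2 * Q * x₁ - 1 + x₁ ^ 2)) := by
  -- With `x = δ` and `τ` defined by `Q * x * (1 + τ) = 1 - x ^ 2`, the last three conditions read
  -- `τ < 1`, `0 < θ + x * τ` and `-x < τ`. Each needs checking at one endpoint only.
  have key : ∀ x ∈ Set.Icc x₁ x₂, 0 < 1 - x ^ 2 ∧ 0 < 2 * Q * x - 1 + x ^ 2 ∧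
      0 < 1 - x ^ 2 + Q * (θ - x) ∧ Q * x < 1 + x := by
    rintro x ⟨h1, h2⟩
    refine ⟨by nlinarith, by nlinarith, by nlinarith, ?_⟩
    by_contra! h
    nlinarith
  have hder : ∀ x ∈ Set.Icc x₁ x₂, HasDerivAt
      (fun x => (x * (1 - x ^ 2 + Q * (θ - x))) ^ 2 / ((1 - x ^ 2) ^ 2 * (2 * Q * x - 1 + x ^ 2)))
      (2 * (x * (1 - x ^ 2 + Q * (θ - x))) * (1 - x ^ 2) *
        ((Q * x - 1) * (1 - x ^ 2) * (1 - x ^ 2 + Q * (θ - x))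
        - Q * x * (1 + x ^ 2 - 2 * x * θ) * (2 * Q * x - 1 + x ^ 2)) /
          ((1 - x ^ 2) ^ 2 * (2 * Q * x - 1 + x ^ 2)) ^ 2) x := by
    intro x hxm
    obtain ⟨h1, h2, h3, h4⟩ := key x hxm
    have hA : HasDerivAt (fun x : ℝ => 1 - x ^ 2) (-(2 * x)) x := by
      simpa using (hasDerivAt_pow 2 x).const_sub 1
    have hB : HasDerivAt (fun x : ℝ => Q * (θ - x)) (-Q) x := by
      simpa using ((hasDerivAt_id x).const_sub θ).const_mul Q
    have hC : HasDerivAt (fun x : ℝ => 2 * Q * x - 1 + x ^ 2) (2 * Q + 2 * x) x := by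
      have h1 : HasDerivAt (fun x : ℝ => 2 * Q * x - 1) (2 * Q) x := by
        simpa using ((hasDerivAt_id x).const_mul (2 * Q)).sub_const 1
      simpa using h1.fun_add (hasDerivAt_pow 2 x)
    have hN' := ((hasDerivAt_id' x).fun_mul (hA.fun_add hB)).fun_pow 2
    have hD' := (hA.fun_pow 2).fun_mul hC
    have hne : (1 - x ^ 2) ^ 2 * (2 * Q * x - 1 + x ^ 2) ≠ 0 := by positivity
    refine (hN'.fun_div hD' hne).congr_deriv ?_
    congr 1
    push_cast
    ring
  have hanti : StrictAntiOn (fun x => (x * (1 - x ^ 2 + Q * (θ - x))) ^ 2 /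
      ((1 - x ^ 2) ^ 2 * (2 * Q * x - 1 + x ^ 2))) (Set.Icc x₁ x₂) := by
    refine strictAntiOn_of_deriv_neg (convex_Icc _ _)
      (fun x hxm => (hder x hxm).continuousAt.continuousWithinAt) fun x hxm => ?_
    rw [interior_Icc] at hxm
    have hxm' := Set.Ioo_subset_Icc_self hxm
    rw [(hder x hxm').deriv]
    obtain ⟨h1, h2, h3, h4⟩ := key x hxm'
    have hx0' : 0 < x := hx0.trans hxm.1
    have := slope_ratio_ineq hx0' (hxm.2.trans hx1) hQ hθ h4 h2 h3
    apply div_neg_of_neg_of_pos _ (by positivity)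
    exact mul_neg_of_pos_of_neg (by positivity) (by linarith)
  exact hanti (Set.left_mem_Icc.2 hx.le) (Set.right_mem_Icc.2 hx.le) hx

/-- Comparison of the curvatures of two half maps with a common slope, in normalized
coordinates. -/
lemma curvature_comparison {δ₁ δ₂ τ₁ τ₂ θ c₁ c₂ : ℝ} (hδ0 : 0 < δ₁) (hδ : δ₁ < δ₂)
    (hδ1 : δ₂ < 1) (hθ : θ < 1) (hτ₁ : -δ₁ < τ₁) (hτ₁' : τ₁ < 1) (hτ₂ : -δ₂ < τ₂)
    (hp₁ : 0 < θ + δ₁ * τ₁) (hp₂ : 0 < θ + δ₂ * τ₂) (hc₂ : 0 < c₂) (hc : c₂ ≤ c₁)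
    (h₁ : c₁ * (θ + δ₁ * τ₁) ^ 2 = (1 - δ₁ ^ 2) * (1 - τ₁ ^ 2))
    (h₂ : c₂ * (θ + δ₂ * τ₂) ^ 2 = (1 - δ₂ ^ 2) * (1 - τ₂ ^ 2)) :
    (1 - δ₂ ^ 2) * δ₁ * (1 + τ₁) < (1 - δ₁ ^ 2) * δ₂ * (1 + τ₂) := by
  -- With `Q = (1 - δ²) / (δ (1 + τ))` the claim is `Q₂ < Q₁`. Otherwise go from `(δ₁, τ₁)` at
  -- constant `Q` to `(δ₂, τ)`, then down to `τ₂ ≤ τ`. The ratio `(θ + δτ)² / ((1 - δ²)(1 - τ²))`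
  -- drops strictly on the first leg and does not rise on the second, yet it leads from `1/c₁` to
  -- `1/c₂ ≥ 1/c₁`.
  by_contra! hcon
  have hs1 : 0 < 1 - δ₁ ^ 2 := by nlinarith
  have hs2 : 0 < 1 - δ₂ ^ 2 := by nlinarith
  have ht1 : 0 < 1 + τ₁ := by linarith
  have ht2 : 0 < 1 + τ₂ := by linarith
  have hδ20 : 0 < δ₂ := hδ0.trans hδ
  obtain ⟨Q, hQ⟩ : ∃ Q, Q = (1 - δ₁ ^ 2) / (δ₁ * (1 + τ₁)) := ⟨_, rfl⟩
  have hQ0 : 0 < Q := by rw [hQ]; positivity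
  have hQ1 : Q * (δ₁ * (1 + τ₁)) = 1 - δ₁ ^ 2 := by rw [hQ]; field_simp
  obtain ⟨τ, hτ⟩ : ∃ τ, τ = (1 - δ₂ ^ 2) / (Q * δ₂) - 1 := ⟨_, rfl⟩
  have hτQ : Q * (δ₂ * (1 + τ)) = 1 - δ₂ ^ 2 := by rw [hτ]; field_simp; ring
  have hle : τ₂ ≤ τ := by
    have : Q * (δ₂ * (1 + τ₂)) ≤ Q * (δ₂ * (1 + τ)) := by
      rw [hτQ]
      have : (1 - δ₁ ^ 2) * δ₂ * (1 + τ₂) = (Q * (δ₂ * (1 + τ₂))) * (δ₁ * (1 + τ₁)) := by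
        rw [← hQ1]; ring
      have h3 : (1 - δ₂ ^ 2) * δ₁ * (1 + τ₁) = (1 - δ₂ ^ 2) * (δ₁ * (1 + τ₁)) := by ring
      rw [this, h3] at hcon
      exact le_of_mul_le_mul_right hcon (by positivity)
    have := le_of_mul_le_mul_left (le_of_mul_le_mul_left this hQ0) hδ20
    linarith
  have hlt : τ < τ₁ := by
    have : Q * δ₂ * (1 + τ) < Q * δ₂ * (1 + τ₁) := by
      have e1 : Q * δ₂ * (1 + τ) = 1 - δ₂ ^ 2 := by rw [← hτQ]; ring
      have : Q * δ₁ * (1 + τ₁) < Q * δ₂ * (1 + τ₁) := by gcongr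
      nlinarith
    have := lt_of_mul_lt_mul_left this (by positivity)
    linarith
  have hpτ : 0 < θ + δ₂ * τ := by nlinarith
  have hQx : Q * δ₂ < 1 + δ₂ := by
    have h1 : Q * δ₂ * (1 + τ) = (1 + δ₂) * (1 - δ₂) := by linear_combination hτQ
    have h2 : 1 - δ₂ < 1 + τ := by linarith
    by_contra! h
    have : (1 + δ₂) * (1 - δ₂) < Q * δ₂ * (1 + τ) :=
      mul_lt_mul' h h2 (by linarith) (by positivity)
    linarith
  have hEeq : ∀ {d t : ℝ}, Q * (d * (1 + t)) = 1 - d ^ 2 →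
      2 * Q * d - 1 + d ^ 2 = Q * d * (1 - t) := by
    intro d t h; linear_combination h
  have hNeq : ∀ {d t : ℝ}, Q * (d * (1 + t)) = 1 - d ^ 2 →
      1 - d ^ 2 + Q * (θ - d) = Q * (θ + d * t) := by
    intro d t h; linear_combination -h
  have hrat := slope_ratio_lt (θ := θ) hδ0 hδ hδ1 hQ0 hθ hQx
    (by rw [hEeq hQ1]; have : 0 < 1 - τ₁ := by linarith
        positivity)
    (by rw [hNeq hτQ]; positivity)
  rw [hEeq hQ1, hNeq hQ1, hEeq hτQ, hNeq hτQ] at hrat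
  have hm1 : 0 < 1 - τ₁ := by linarith
  have hm : 0 < 1 - τ := by linarith
  have hm0 : 0 < 1 + τ := by linarith
  have hsimp : ∀ {d t : ℝ}, 0 < d → 0 < 1 + t → 0 < 1 - t → 0 < 1 - d ^ 2 →
      Q * (d * (1 + t)) = 1 - d ^ 2 →
      (d * (Q * (θ + d * t))) ^ 2 / ((1 - d ^ 2) ^ 2 * (Q * d * (1 - t))) =
      (θ + d * t) ^ 2 / ((1 - d ^ 2) * (1 - t ^ 2)) := by
    intro d t hd h1 h2 h3 h
    have e : 1 - t ^ 2 = (1 + t) * (1 - t) := by ring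
    rw [e, div_eq_div_iff (by positivity) (by positivity)]
    linear_combination (-(1 - d ^ 2) * (1 - t) * Q * d * (θ + d * t) ^ 2) * (-h)
  rw [hsimp hδ0 ht1 hm1 hs1 hQ1, hsimp hδ20 hm0 hm hs2 hτQ] at hrat
  -- The derivative of `(θ + δ₂ t)² / (1 - t²)` has the sign of `(θ + δ₂ t)(δ₂ + θ t)`; `hpos`
  -- handles the second factor.
  have hmono : (θ + δ₂ * τ₂) ^ 2 * (1 - τ ^ 2) ≤ (θ + δ₂ * τ) ^ 2 * (1 - τ₂ ^ 2) := by
    have hpos : ∀ t, -δ₂ < t → t < 1 → 0 < θ + δ₂ * t → 0 ≤ δ₂ + θ * t := by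
      intro t h1 h2 h3
      rcases le_or_gt 0 t with h | h
      · have : -(δ₂ * t) * t ≤ θ * t := by
          apply mul_le_mul_of_nonneg_right _ h; linarith
        have : δ₂ * (t * t) ≤ δ₂ * 1 := by
          apply mul_le_mul_of_nonneg_left _ hδ20.le; nlinarith
        linarith
      · have : 1 * t ≤ θ * t := mul_le_mul_of_nonpos_right hθ.le h.le
        linarith
    have a1 := hpos τ₂ hτ₂ (by linarith) hp₂
    have a2 := hpos τ (by linarith) (by linarith) hpτ
    have : 0 ≤ (τ - τ₂) * ((θ + δ₂ * τ₂) * (δ₂ + θ * τ) + (θ + δ₂ * τ) * (δ₂ + θ * τ₂)) := by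
      apply mul_nonneg (by linarith); positivity
    linarith
  have hsq : ∀ {t : ℝ}, 0 < 1 + t → 0 < 1 - t → 0 < 1 - t ^ 2 := by
    intro t h1 h2
    have e : 1 - t ^ 2 = (1 + t) * (1 - t) := by ring
    rw [e]; exact mul_pos h1 h2
  have q1 : 0 < (1 - δ₁ ^ 2) * (1 - τ₁ ^ 2) := mul_pos hs1 (hsq ht1 hm1)
  have q : 0 < 1 - τ ^ 2 := hsq hm0 hm
  have q2 : 0 < 1 - τ₂ ^ 2 := hsq ht2 (by linarith)
  rw [← h₁, div_lt_div_iff₀ (by positivity) (by rw [h₁]; exact q1)] at hrat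
  have hsq1 : 0 < (θ + δ₁ * τ₁) ^ 2 := by positivity
  have r1 : (θ + δ₂ * τ) ^ 2 * c₁ < (1 - δ₂ ^ 2) * (1 - τ ^ 2) := by
    have : (θ + δ₁ * τ₁) ^ 2 * ((θ + δ₂ * τ) ^ 2 * c₁)
        < (θ + δ₁ * τ₁) ^ 2 * ((1 - δ₂ ^ 2) * (1 - τ ^ 2)) := by linarith
    exact lt_of_mul_lt_mul_left this hsq1.le
  have r2 : (θ + δ₂ * τ) ^ 2 * c₂ < (1 - δ₂ ^ 2) * (1 - τ ^ 2) :=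
    (mul_le_mul_of_nonneg_left hc (sq_nonneg _)).trans_lt r1
  have r3 : (θ + δ₂ * τ) ^ 2 * c₂ * (1 - τ₂ ^ 2) < (1 - δ₂ ^ 2) * (1 - τ ^ 2) * (1 - τ₂ ^ 2) :=
    mul_lt_mul_of_pos_right r2 q2
  have r4 := mul_le_mul_of_nonneg_left hmono hc₂.le
  have r5 : c₂ * (θ + δ₂ * τ₂) ^ 2 * (1 - τ ^ 2) = (1 - δ₂ ^ 2) * (1 - τ₂ ^ 2) * (1 - τ ^ 2) := by
    rw [h₂]
  linarith

/-- The normalized coordinates of a half map at a point `(y₀, y₁)` of slope `m`. -/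
lemma normalized_half_map {α l k y₀ y₁ m : ℝ} (hα : 0 < α) (hk : 0 < k) (hkl : k < l)
    (h0 : 0 < y₀) (h01 : y₀ < y₁) (hly : l * y₀ < α) (hm : 0 < m)
    (h : m * y₁ * ((α - l * y₀) * (α - k * y₀)) = y₀ * ((α + l * y₁) * (α + k * y₁)))
    {δ τ θ : ℝ} (hδ : δ = (y₁ - y₀) / (y₁ + y₀)) (hθ : θ = (m - 1) / (m + 1))
    (hτ : τ = (α ^ 2 - l * k * (y₀ * y₁)) / (α ^ 2 + l * k * (y₀ * y₁))) :
    -δ < τ ∧ τ < 1 ∧ 0 < θ + δ * τ ∧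
      4 * (l * k) / (l + k) ^ 2 * (θ + δ * τ) ^ 2 = (1 - δ ^ 2) * (1 - τ ^ 2) ∧
      (α - l * y₀) * (α - k * y₀) * (y₁ * (1 + m))
        = (y₁ + y₀) * (α ^ 2 + l * k * (y₀ * y₁)) := by
  have hl : 0 < l := hk.trans hkl
  have h1 : 0 < y₁ := h0.trans h01
  have hky : k * y₀ < α := by nlinarith
  have hS : 0 < y₁ + y₀ := by linarith
  have hw : 0 < l * k * (y₀ * y₁) := by positivity
  have hsum : θ + δ * τ = 2 * (l + k) * α * (y₀ * y₁) /
      ((y₁ + y₀) * (α ^ 2 + l * k * (y₀ * y₁))) := by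
    rw [hδ, hθ, hτ]
    field_simp
    linear_combination 2 * h
  refine ⟨?_, ?_, ?_, ?_, ?_⟩
  · rw [hδ, hτ, ← sub_pos]
    have : (α ^ 2 - l * k * (y₀ * y₁)) / (α ^ 2 + l * k * (y₀ * y₁)) - -((y₁ - y₀) / (y₁ + y₀))
      = 2 * y₁ * (α ^ 2 - (l * y₀) * (k * y₀)) / ((α ^ 2 + l * k * (y₀ * y₁)) * (y₁ + y₀)) := by
      field_simp; ring
    rw [this]
    have : (l * y₀) * (k * y₀) < α ^ 2 := by
      rw [sq]; exact mul_lt_mul'' hly hky (by positivity) (by positivity)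
    have : 0 < α ^ 2 - (l * y₀) * (k * y₀) := by linarith
    positivity
  · rw [hτ, div_lt_one (by positivity)]; linarith
  · rw [hsum]; positivity
  · rw [hsum, hδ, hτ]; field_simp; ring
  · linear_combination h

/-- Comparison of the second derivatives of two half maps that are tangent to each other. -/
lemma tangency_curvature {α l k β σ ν y₀ y₁ b m : ℝ} (hα : 0 < α) (hk : 0 < k) (hkl : k < l)
    (hβ : 0 < β) (hν : 0 < ν) (hνσ : ν < σ) (hc : 4 * (σ * ν) / (σ + ν) ^ 2 ≤ 4 * (l * k) / (l + k) ^ 2)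
    (hb : 0 < b) (h0 : b < y₀) (h01 : y₀ < y₁) (hly : l * y₀ < α) (hσy : σ * (y₀ - b) < β)
    (hm : 0 < m)
    (hL : m * y₁ * ((α - l * y₀) * (α - k * y₀)) = y₀ * ((α + l * y₁) * (α + k * y₁)))
    (hR : m * (y₁ + b) * ((β - σ * (y₀ - b)) * (β - ν * (y₀ - b)))
      = (y₀ - b) * ((β + σ * (y₁ + b)) * (β + ν * (y₁ + b)))) :
    α ^ 2 * ((y₁ - y₀) * ((y₀ - b) * (y₁ + b) ^ 2 * ((β - σ * (y₀ - b)) * (β - ν * (y₀ - b)))))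
    < β ^ 2 * (((y₁ + b) - (y₀ - b)) * (y₀ * y₁ ^ 2 * ((α - l * y₀) * (α - k * y₀)))) := by
  have hy0 : 0 < y₀ := hb.trans h0
  have hy1 : 0 < y₁ := hy0.trans h01
  have hv : 0 < y₀ - b := by linarith
  have hσ := hν.trans hνσ
  have hl := hk.trans hkl
  obtain ⟨a1, a2, a3, a4, a5⟩ := normalized_half_map hα hk hkl hy0 h01 hly hm hL rfl rfl rfl
  obtain ⟨b1, b2, b3, b4, b5⟩ := normalized_half_map hβ hν hνσ hv
    (by linarith : y₀ - b < y₁ + b) hσy hm hR rfl rfl rfl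
  -- The shift preserves the sum, so the two values of `δ` share a denominator and the right
  -- numerator is larger by `2 * b`.
  have hSS : y₁ + b + (y₀ - b) = y₁ + y₀ := by ring
  have hS : 0 < y₁ + y₀ := by linarith
  rw [hSS] at b1 b3 b4 b5
  have key := curvature_comparison (div_pos (by linarith) hS)
    (div_lt_div_of_pos_right (by linarith : y₁ - y₀ < y₁ + b - (y₀ - b)) hS) (by rw [div_lt_one hS]; linarith)
    (by rw [div_lt_one (by positivity)]; linarith) a1 a2 b1 a3 b3 (by positivity) hc a4 b4
  set V₀ := y₁ + b with hV0
  set V₁ := y₀ - b with hV1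
  have hV0p : 0 < V₀ := by linarith
  have e : ∀ {u v : ℝ}, v + u = y₁ + y₀ → 1 - ((v - u) / (y₁ + y₀)) ^ 2
      = 4 * (u * v) / (y₁ + y₀) ^ 2 := by
    intro u v h; rw [← h] at hS ⊢; field_simp; ring
  have e' : ∀ {A B : ℝ}, 0 < A ^ 2 + B → 1 + (A ^ 2 - B) / (A ^ 2 + B) = 2 * A ^ 2 / (A ^ 2 + B) := by
    intro A B h; field_simp; ring
  have hwL : 0 < α ^ 2 + l * k * (y₀ * y₁) := by positivity
  have hwR : 0 < β ^ 2 + σ * ν * (V₁ * V₀) := by positivity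
  rw [e rfl, e hSS, e' hwL, e' hwR] at key
  have key2 : α ^ 2 * (V₁ * V₀ * (y₁ - y₀)) * (β ^ 2 + σ * ν * (V₁ * V₀))
      < β ^ 2 * (y₀ * y₁ * (V₀ - V₁)) * (α ^ 2 + l * k * (y₀ * y₁)) := by
    have l1 : 4 * (V₁ * V₀) / (y₁ + y₀) ^ 2 * ((y₁ - y₀) / (y₁ + y₀)) *
        (2 * α ^ 2 / (α ^ 2 + l * k * (y₀ * y₁))) =
        8 / (y₁ + y₀) ^ 3 * (α ^ 2 * (V₁ * V₀ * (y₁ - y₀)) / (α ^ 2 + l * k * (y₀ * y₁))) := by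
      field_simp; ring
    have l2 : 4 * (y₀ * y₁) / (y₁ + y₀) ^ 2 * ((V₀ - V₁) / (y₁ + y₀)) *
        (2 * β ^ 2 / (β ^ 2 + σ * ν * (V₁ * V₀))) =
        8 / (y₁ + y₀) ^ 3 * (β ^ 2 * (y₀ * y₁ * (V₀ - V₁)) / (β ^ 2 + σ * ν * (V₁ * V₀))) := by
      field_simp; ring
    rw [l1, l2] at key
    have := lt_of_mul_lt_mul_left key (by positivity)
    rwa [div_lt_div_iff₀ hwL hwR] at this
  have hfin := mul_lt_mul_of_pos_left key2 hS
  have : (1 + m) * (α ^ 2 * ((y₁ - y₀) * (V₁ * V₀ ^ 2 * ((β - σ * V₁) * (β - ν * V₁)))))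
      < (1 + m) * (β ^ 2 * ((V₀ - V₁) * (y₀ * y₁ ^ 2 * ((α - l * y₀) * (α - k * y₀))))) := by
    have r1 : (1 + m) * (α ^ 2 * ((y₁ - y₀) * (V₁ * V₀ ^ 2 * ((β - σ * V₁) * (β - ν * V₁)))))
       = (y₁ + y₀) * (α ^ 2 * (V₁ * V₀ * (y₁ - y₀)) * (β ^ 2 + σ * ν * (V₁ * V₀))) := by
      linear_combination (α ^ 2 * (V₁ * V₀ * (y₁ - y₀))) * b5
    have r2 : (1 + m) * (β ^ 2 * ((V₀ - V₁) * (y₀ * y₁ ^ 2 * ((α - l * y₀) * (α - k * y₀)))))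
       = (y₁ + y₀) * (β ^ 2 * (y₀ * y₁ * (V₀ - V₁)) * (α ^ 2 + l * k * (y₀ * y₁))) := by
      linear_combination (β ^ 2 * (y₀ * y₁ * (V₀ - V₁))) * a5
    rw [r1, r2]; exact hfin
  exact lt_of_mul_lt_mul_left this (by positivity)

end NodeNode

/-! ### Half maps parametrized by flight time -/

namespace NodeNode

/-- The height at which an orbit of a half map with flight time `s` starts. -/
noncomputable def halfStart (α l k s : ℝ) : ℝ :=
  α * ((Real.exp (l * s) - 1) / l - (Real.exp (k * s) - 1) / k) /
    (Real.exp (l * s) - Real.exp (k * s))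

/-- The depth at which an orbit of a half map with flight time `s` ends. -/
noncomputable def halfEnd (α l k s : ℝ) : ℝ :=
  α * (Real.exp (l * s) - 1) / l - Real.exp (l * s) * halfStart α l k s

/-- The flight from `y₀` to `-y₁` takes time `s`: this is how the two eigencoordinates evolve. -/
def IsHalfFlight (α l k s y₀ y₁ : ℝ) : Prop :=
  α + l * y₁ = Real.exp (l * s) * (α - l * y₀) ∧ α + k * y₁ = Real.exp (k * s) * (α - k * y₀)

lemma exp_sub_one_div_lt {x y : ℝ} (hx : x ≠ 0) (hy : y ≠ 0) (h : x < y) :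
    (Real.exp x - 1) / x < (Real.exp y - 1) / y := by
  have := strictConvexOn_exp.secant_strict_mono (Set.mem_univ (0 : ℝ)) (Set.mem_univ x)
    (Set.mem_univ y) hx hy h
  simpa using this

section HalfMap

variable {α l k s : ℝ}

lemma exp_gap_pos (hkl : k < l) (hs : 0 < s) : 0 < Real.exp (l * s) - Real.exp (k * s) := by
  rw [sub_pos, Real.exp_lt_exp]; gcongr

lemma halfStart_pos (hα : 0 < α) (hk : 0 < k) (hkl : k < l) (hs : 0 < s) :
    0 < halfStart α l k s := by
  have hl := hk.trans hkl
  have h := exp_sub_one_div_lt (mul_pos hk hs).ne' (mul_pos hl hs).ne' (by gcongr : k * s < l * s)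
  have h2 : (Real.exp (k * s) - 1) / k < (Real.exp (l * s) - 1) / l := by
    have := mul_lt_mul_of_pos_right h hs
    have e : ∀ c, c ≠ 0 → (Real.exp (c * s) - 1) / (c * s) * s = (Real.exp (c * s) - 1) / c := by
      intro c hc; field_simp
    rwa [e k hk.ne', e l hl.ne'] at this
  exact div_pos (mul_pos hα (by linarith)) (exp_gap_pos hkl hs)

/-- Reversing time exchanges start and end, so the secant slopes of `exp` are now compared at `-(l *
s)` and `-(k * s)`. -/
lemma halfEnd_pos (hα : 0 < α) (hk : 0 < k) (hkl : k < l) (hs : 0 < s) :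
    0 < halfEnd α l k s := by
  have hl := hk.trans hkl
  have h := exp_sub_one_div_lt (x := -(l * s)) (y := -(k * s))
    (neg_ne_zero.2 (mul_pos hl hs).ne') (neg_ne_zero.2 (mul_pos hk hs).ne')
    (neg_lt_neg (by gcongr : k * s < l * s))
  have hgap := exp_gap_pos hkl hs
  have e : halfEnd α l k s = α * s * Real.exp (l * s) * Real.exp (k * s) /
      (Real.exp (l * s) - Real.exp (k * s)) *
      ((Real.exp (-(k * s)) - 1) / (-(k * s)) - (Real.exp (-(l * s)) - 1) / (-(l * s))) := by
    rw [halfEnd, halfStart, Real.exp_neg, Real.exp_neg]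
    have h1 := Real.exp_pos (l * s)
    have h2 := Real.exp_pos (k * s)
    generalize Real.exp (l * s) = A at hgap h1 ⊢
    generalize Real.exp (k * s) = B at hgap h2 ⊢
    have hne := hgap.ne'
    field_simp
    ring
  rw [e]
  exact mul_pos (by positivity) (by linarith)

lemma isHalfFlight_iff (hk : 0 < k) (hkl : k < l) (hs : 0 < s) {y₀ y₁ : ℝ} :
    IsHalfFlight α l k s y₀ y₁ ↔ y₀ = halfStart α l k s ∧ y₁ = halfEnd α l k s := by
  have hl := hk.trans hkl
  have hgap := exp_gap_pos hkl hs
  have hne := hgap.ne'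
  rw [IsHalfFlight, halfEnd, halfStart]
  generalize Real.exp (l * s) = A at hne ⊢
  generalize Real.exp (k * s) = B at hne ⊢
  constructor
  · rintro ⟨h1, h2⟩
    have h0 : y₀ = α * ((A - 1) / l - (B - 1) / k) / (A - B) := by
      field_simp
      linear_combination k * h1 - l * h2
    refine ⟨h0, ?_⟩
    rw [← h0]
    field_simp
    linear_combination h1
  · rintro ⟨rfl, rfl⟩
    constructor
    · field_simp; ring
    · field_simp; ring

lemma isHalfFlight_half (hk : 0 < k) (hkl : k < l) (hs : 0 < s) :
    IsHalfFlight α l k s (halfStart α l k s) (halfEnd α l k s) :=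
  (isHalfFlight_iff hk hkl hs).2 ⟨rfl, rfl⟩

lemma hasDerivAt_exp_mul (c s : ℝ) :
    HasDerivAt (fun s => Real.exp (c * s)) (c * Real.exp (c * s)) s := by
  have := ((hasDerivAt_id' s).const_mul c).exp
  simpa [mul_comm] using this

/-- The factor `(l - k) / (exp (l * s) - exp (k * s))` also occurs in the derivative of `halfEnd`;
it cancels in the quotient, giving the half map the slope `exp ((l + k) * s) * y₀ / y₁`. -/
lemma hasDerivAt_halfStart (hk : 0 < k) (hkl : k < l) (hs : 0 < s) :
    HasDerivAt (halfStart α l k)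
      ((l - k) / (Real.exp (l * s) - Real.exp (k * s)) * halfEnd α l k s) s := by
  have hl := hk.trans hkl
  have hgap := exp_gap_pos hkl hs
  have hN := ((((hasDerivAt_exp_mul l s).sub_const 1).div_const l).fun_sub
    (((hasDerivAt_exp_mul k s).sub_const 1).div_const k)).const_mul α
  have hD := (hasDerivAt_exp_mul l s).fun_sub (hasDerivAt_exp_mul k s)
  refine (hN.fun_div hD hgap.ne').congr_deriv ?_
  rw [halfEnd, halfStart]
  generalize Real.exp (l * s) = A at hgap ⊢
  generalize Real.exp (k * s) = B at hgap ⊢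
  have hne := hgap.ne'
  field_simp
  ring

lemma hasDerivAt_halfEnd (hk : 0 < k) (hkl : k < l) (hs : 0 < s) :
    HasDerivAt (halfEnd α l k)
      ((l - k) / (Real.exp (l * s) - Real.exp (k * s)) *
        (Real.exp ((l + k) * s) * halfStart α l k s)) s := by
  have hl := hk.trans hkl
  have hgap := exp_gap_pos hkl hs
  have h1 := (((hasDerivAt_exp_mul l s).sub_const 1).const_mul α).div_const l
  have h2 := (hasDerivAt_exp_mul l s).fun_mul (hasDerivAt_halfStart (α := α) hk hkl hs)
  refine (h1.fun_sub h2).congr_deriv ?_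
  rw [add_mul, Real.exp_add, halfEnd, halfStart]
  generalize Real.exp (l * s) = A at hgap ⊢
  generalize Real.exp (k * s) = B at hgap ⊢
  have hne := hgap.ne'
  field_simp
  ring

lemma halfStart_strictMonoOn (hα : 0 < α) (hk : 0 < k) (hkl : k < l) :
    StrictMonoOn (halfStart α l k) (Set.Ioi 0) := by
  refine strictMonoOn_of_deriv_pos (convex_Ioi 0)
    (fun s hs => (hasDerivAt_halfStart hk hkl hs).continuousAt.continuousWithinAt) fun s hs => ?_
  rw [interior_Ioi] at hs
  rw [(hasDerivAt_halfStart hk hkl hs).deriv]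
  exact mul_pos (div_pos (by linarith) (exp_gap_pos hkl hs)) (halfEnd_pos hα hk hkl hs)

lemma halfEnd_strictMonoOn (hα : 0 < α) (hk : 0 < k) (hkl : k < l) :
    StrictMonoOn (halfEnd α l k) (Set.Ioi 0) := by
  refine strictMonoOn_of_deriv_pos (convex_Ioi 0)
    (fun s hs => (hasDerivAt_halfEnd hk hkl hs).continuousAt.continuousWithinAt) fun s hs => ?_
  rw [interior_Ioi] at hs
  rw [(hasDerivAt_halfEnd hk hkl hs).deriv]
  exact mul_pos (div_pos (by linarith) (exp_gap_pos hkl hs))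
    (mul_pos (Real.exp_pos _) (halfStart_pos hα hk hkl hs))

/-- The eigencoordinate keeps its sign during the flight and ends at `α + l * y₁ > 0`. -/
lemma mul_halfStart_lt (hα : 0 < α) (hk : 0 < k) (hkl : k < l) (hs : 0 < s) :
    l * halfStart α l k s < α := by
  have hl := hk.trans hkl
  have h1 := (isHalfFlight_half (α := α) hk hkl hs).1
  have h2 := halfEnd_pos hα hk hkl hs
  have : 0 < Real.exp (l * s) * (α - l * halfStart α l k s) := by rw [← h1]; positivity
  have := (mul_pos_iff_of_pos_left (Real.exp_pos _)).1 this
  linarith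

lemma halfStart_lt (hα : 0 < α) (hk : 0 < k) (hkl : k < l) (hs : 0 < s) :
    halfStart α l k s < α * s := by
  have hl := hk.trans hkl
  have h1 := (isHalfFlight_half (α := α) hk hkl hs).1
  have h2 := halfEnd_pos hα hk hkl hs
  have h3 : α < Real.exp (l * s) * (α - l * halfStart α l k s) := by
    rw [← h1]; linarith [mul_pos hl h2]
  have h4 : Real.exp (-(l * s)) * α < α - l * halfStart α l k s := by
    have := mul_lt_mul_of_pos_left h3 (Real.exp_pos (-(l * s)))
    rwa [← mul_assoc, ← Real.exp_add, neg_add_cancel, Real.exp_zero, one_mul] at this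
  have h5 := mul_le_mul_of_nonneg_right (Real.one_sub_le_exp_neg (l * s)) hα.le
  have : l * halfStart α l k s < l * (α * s) := by linarith
  exact lt_of_mul_lt_mul_left this hl.le

/-- Since `l + k > 0`, the derivative of `y₁² - y₀²` is positive; as `y₀ < α * s`, this difference
cannot start below `0` at `s = 0`. -/
lemma halfStart_lt_halfEnd (hα : 0 < α) (hk : 0 < k) (hkl : k < l) (hs : 0 < s) :
    halfStart α l k s < halfEnd α l k s := by
  have hl := hk.trans hkl
  have hder : ∀ s : ℝ, 0 < s →
      HasDerivAt (fun s => halfEnd α l k s ^ 2 - halfStart α l k s ^ 2)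
        (2 * ((l - k) / (Real.exp (l * s) - Real.exp (k * s))) *
          (halfStart α l k s * halfEnd α l k s) * (Real.exp ((l + k) * s) - 1)) s := by
    intro s hs
    refine (((hasDerivAt_halfEnd hk hkl hs).fun_pow 2).fun_sub
      ((hasDerivAt_halfStart hk hkl hs).fun_pow 2)).congr_deriv ?_
    push_cast
    ring
  have hmono : StrictMonoOn (fun s => halfEnd α l k s ^ 2 - halfStart α l k s ^ 2)
      (Set.Ioi 0) := by
    refine strictMonoOn_of_deriv_pos (convex_Ioi 0)
      (fun s hs => (hder s hs).continuousAt.continuousWithinAt) fun s hs => ?_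
    rw [interior_Ioi] at hs
    have hs' : 0 < s := hs
    rw [(hder s hs).deriv]
    have h1 := halfStart_pos hα hk hkl hs
    have h2 := halfEnd_pos hα hk hkl hs
    have h3 := exp_gap_pos hkl hs
    have h4 : 0 < Real.exp ((l + k) * s) - 1 := by
      rw [sub_pos, Real.one_lt_exp_iff]; positivity
    have : 0 < l - k := by linarith
    positivity
  have hhalf : 0 ≤ halfEnd α l k (s / 2) ^ 2 - halfStart α l k (s / 2) ^ 2 := by
    by_contra! hneg
    obtain ⟨ε, hε0, hεs, hε⟩ : ∃ ε, 0 < ε ∧ ε < s / 2 ∧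
        halfEnd α l k (s / 2) ^ 2 - halfStart α l k (s / 2) ^ 2 < -(α * ε) ^ 2 := by
      set c := halfEnd α l k (s / 2) ^ 2 - halfStart α l k (s / 2) ^ 2
      have hc : Filter.Tendsto (fun ε : ℝ => -(α * ε) ^ 2) (nhdsWithin 0 (Set.Ioi 0))
          (nhds (-(α * 0) ^ 2)) := by
        apply Filter.Tendsto.mono_left _ nhdsWithin_le_nhds
        exact (by fun_prop : Continuous fun ε : ℝ => -(α * ε) ^ 2).tendsto 0
      have h1 := hc.eventually (lt_mem_nhds (by simpa using hneg))
      have h2 : ∀ᶠ ε in nhdsWithin (0 : ℝ) (Set.Ioi 0), ε ∈ Set.Ioo 0 (s / 2) :=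
        Ioo_mem_nhdsGT (by linarith)
      obtain ⟨ε, h3, h4⟩ := (h1.and h2).exists
      exact ⟨ε, h4.1, h4.2, h3⟩
    have h1 := hmono (Set.mem_Ioi.2 hε0) (Set.mem_Ioi.2 (hε0.trans hεs)) hεs
    have h2 := halfStart_lt hα hk hkl hε0
    have h3 := halfStart_pos hα hk hkl hε0
    have h4 : halfStart α l k ε ^ 2 < (α * ε) ^ 2 := by gcongr
    simp only at h1
    nlinarith [sq_nonneg (halfEnd α l k ε)]
  have h1 := hmono (Set.mem_Ioi.2 (half_pos hs)) (Set.mem_Ioi.2 hs) (half_lt_self hs)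
  simp only at h1
  exact lt_of_pow_lt_pow_left₀ 2 (halfEnd_pos hα hk hkl hs).le (by linarith)

/-- The product of the eigencoordinates at the start of the flight. -/
lemma halfStart_eigenproduct (hk : 0 < k) (hkl : k < l) (hs : 0 < s) :
    (α - l * halfStart α l k s) * (α - k * halfStart α l k s) =
      (l - k) / (Real.exp (l * s) - Real.exp (k * s)) *
        (α * (halfStart α l k s + halfEnd α l k s)) := by
  have hgap := exp_gap_pos hkl hs
  obtain ⟨h1, h2⟩ := isHalfFlight_half (α := α) hk hkl hs
  set y₀ := halfStart α l k s
  set y₁ := halfEnd α l k s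
  rw [div_mul_eq_mul_div, eq_div_iff hgap.ne']
  linear_combination (α - l * y₀) * h2 - (α - k * y₀) * h1

lemma halfEnd_eigenproduct (hk : 0 < k) (hkl : k < l) (hs : 0 < s) :
    (α + l * halfEnd α l k s) * (α + k * halfEnd α l k s) = Real.exp ((l + k) * s) *
      ((α - l * halfStart α l k s) * (α - k * halfStart α l k s)) := by
  obtain ⟨h1, h2⟩ := isHalfFlight_half (α := α) hk hkl hs
  rw [h1, h2, add_mul, Real.exp_add]
  ring

end HalfMap

end NodeNode

/-! ### Uniqueness of the matching flight -/

namespace NodeNode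

/-- First integral of a node along the switching line. -/
noncomputable def nodeIntegral (β σ ν v : ℝ) : ℝ :=
  Real.log (β - ν * v) / ν - Real.log (β - σ * v) / σ

lemma hasDerivAt_nodeIntegral {β σ ν v : ℝ} (hν : 0 < ν) (hνσ : ν < σ)
    (h1 : 0 < β - σ * v) (h2 : 0 < β - ν * v) :
    HasDerivAt (nodeIntegral β σ ν) ((σ - ν) * v / ((β - σ * v) * (β - ν * v))) v := by
  have hσ := hν.trans hνσ
  have hd : ∀ c, HasDerivAt (fun v => β - c * v) (-c) v := fun c => by
    simpa using ((hasDerivAt_id' v).const_mul c).const_sub β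
  refine ((((hd ν).log h2.ne').div_const ν).fun_sub
    (((hd σ).log h1.ne').div_const σ)).congr_deriv ?_
  have n1 := h1.ne'
  have n2 := h2.ne'
  have n3 := hσ.ne'
  have n4 := hν.ne'
  rw [neg_div, neg_div, neg_div, neg_div, div_div, div_div, sub_neg_eq_add, neg_add_eq_sub,
    div_sub_div _ _ (by positivity) (by positivity), div_eq_div_iff (by positivity) (by positivity)]
  ring

lemma nodeIntegral_strictAntiOn {β σ ν : ℝ} (hβ : 0 < β) (hν : 0 < ν) (hνσ : ν < σ) :
    StrictAntiOn (nodeIntegral β σ ν) (Set.Iic 0) := by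
  have hσ := hν.trans hνσ
  have hpos : ∀ c, 0 < c → ∀ v ≤ (0 : ℝ), 0 < β - c * v := fun c hc v hv => by nlinarith
  refine strictAntiOn_of_deriv_neg (convex_Iic 0) (fun v hv =>
    (hasDerivAt_nodeIntegral hν hνσ (hpos _ hσ v hv)
      (hpos _ hν v hv)).continuousAt.continuousWithinAt) fun v hv => ?_
  rw [interior_Iic] at hv
  have hv' : v < 0 := hv
  rw [(hasDerivAt_nodeIntegral hν hνσ (hpos _ hσ v hv'.le) (hpos _ hν v hv'.le)).deriv]
  exact div_neg_of_neg_of_pos (mul_neg_of_pos_of_neg (by linarith) hv')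
    (mul_pos (hpos _ hσ v hv'.le) (hpos _ hν v hv'.le))

/-- For each eigenvalue, the logarithm of the eigencoordinate divided by the eigenvalue grows by the
flight time, which cancels in the difference. -/
lemma IsHalfFlight.nodeIntegral_eq {β σ ν t v₁ v₀ : ℝ} (hν : 0 < ν) (hνσ : ν < σ)
    (h : IsHalfFlight β σ ν t v₁ v₀) (h1 : 0 < β - σ * v₁) (h2 : 0 < β - ν * v₁) :
    nodeIntegral β σ ν v₁ = nodeIntegral β σ ν (-v₀) := by
  have hσ := hν.trans hνσ
  have e : ∀ c, β - c * -v₀ = β + c * v₀ := fun c => by ring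
  rw [nodeIntegral, nodeIntegral, e, e, h.1, h.2, Real.log_mul (Real.exp_pos _).ne' h1.ne',
    Real.log_mul (Real.exp_pos _).ne' h2.ne', Real.log_exp, Real.log_exp]
  field_simp
  ring

/-- A difference of slopes increases through each of its zeros. -/
lemma slope_difference_deriv_pos {α l k β σ ν y₀ y₁ b X ω : ℝ} (hα : 0 < α) (hk : 0 < k)
    (hkl : k < l) (hβ : 0 < β) (hν : 0 < ν) (hνσ : ν < σ)
    (hc : 4 * (σ * ν) / (σ + ν) ^ 2 ≤ 4 * (l * k) / (l + k) ^ 2)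
    (hb : 0 < b) (h0 : b < y₀) (h01 : y₀ < y₁) (hly : l * y₀ < α) (hσy : σ * (y₀ - b) < β)
    (hX : 0 < X) (hω : 0 < ω)
    (hP : (α - l * y₀) * (α - k * y₀) = ω * (α * (y₀ + y₁)))
    (hXP : (α + l * y₁) * (α + k * y₁) = X * ((α - l * y₀) * (α - k * y₀)))
    {PR QR dP dQ : ℝ} (hPR : PR = (β - σ * (y₀ - b)) * (β - ν * (y₀ - b)))
    (hQR : QR = (β + σ * (y₁ + b)) * (β + ν * (y₁ + b)))
    (hdP : dP = -(σ * (β - ν * (y₀ - b)) + ν * (β - σ * (y₀ - b))))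
    (hdQ : dQ = σ * (β + ν * (y₁ + b)) + ν * (β + σ * (y₁ + b)))
    (hzero : (y₀ - b) * y₁ * QR - (y₁ + b) * y₀ * X * PR = 0) :
    0 < ω * y₁ * y₁ * QR + (y₀ - b) * (ω * (X * y₀)) * QR + (y₀ - b) * y₁ * (dQ * (ω * (X * y₀)))
      - (ω * (X * y₀) * y₀ * X * PR + (y₁ + b) * (ω * y₁) * X * PR
        + (y₁ + b) * y₀ * ((l + k) * X) * PR + (y₁ + b) * y₀ * X * (dP * (ω * y₁))) := by
  have hy0 : 0 < y₀ := hb.trans h0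
  have hy1 : 0 < y₁ := hy0.trans h01
  have hl := hk.trans hkl
  have hσ := hν.trans hνσ
  have hV1 : 0 < y₀ - b := by linarith
  have hV0 : 0 < y₁ + b := by linarith
  have hP0 : 0 < (α - l * y₀) * (α - k * y₀) := by
    have : k * y₀ < l * y₀ := by gcongr
    exact mul_pos (by linarith) (by linarith)
  have hPR0 : 0 < PR := by
    have : ν * (y₀ - b) < σ * (y₀ - b) := by gcongr
    rw [hPR]; exact mul_pos (by linarith) (by linarith)
  obtain ⟨m, hm⟩ : ∃ m, m = X * y₀ / y₁ := ⟨_, rfl⟩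
  have hm0 : 0 < m := by rw [hm]; positivity
  have hmX : m * y₁ = X * y₀ := by rw [hm]; field_simp
  have hmR : m * (y₁ + b) * PR = (y₀ - b) * QR := by
    have : y₁ * (m * (y₁ + b) * PR) = y₁ * ((y₀ - b) * QR) := by
      linear_combination (y₁ + b) * PR * hmX - hzero
    exact mul_left_cancel₀ hy1.ne' this
  have hmL : m * y₁ * ((α - l * y₀) * (α - k * y₀)) = y₀ * ((α + l * y₁) * (α + k * y₁)) := by
    rw [hmX, hXP]; ring
  have htan := tangency_curvature hα hk hkl hβ hν hνσ hc hb h0 h01 hly hσy hm0 hmL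
    (by rw [← hPR, ← hQR]; exact hmR)
  rw [← hPR] at htan
  set V₁ := y₀ - b with hV1e
  set V₀ := y₁ + b with hV0e
  set P := (α - l * y₀) * (α - k * y₀) with hPe
  -- `hA1` and `hA2` evaluate the logarithmic derivatives with respect to `y₀`, along the left
  -- curve, of the right slope `V₁ * QR / (V₀ * PR)` and of the left slope; `hD` writes the goal as
  -- a positive multiple of their difference.
  have hA1 : 1 / V₁ - m / V₀ + V₁ * dQ / (V₀ * PR) - dP / PR
      = β ^ 2 * (V₀ ^ 2 - V₁ ^ 2) / (V₁ * V₀ ^ 2 * PR) := by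
    have : V₀ ^ 2 * PR - V₁ * (m * V₀ * PR) + V₁ ^ 2 * V₀ * dQ - V₁ * V₀ ^ 2 * dP
        = β ^ 2 * (V₀ ^ 2 - V₁ ^ 2) := by
      rw [hmR, hdQ, hdP, hPR, hQR]; ring
    rw [← this]
    field_simp
  have hA2 : 1 / y₀ - m / y₁ + (l + k) / (ω * y₁)
      = α ^ 2 * (y₁ ^ 2 - y₀ ^ 2) / (y₀ * y₁ ^ 2 * P) := by
    have hω' : ω = P / (α * (y₀ + y₁)) := by rw [hP]; field_simp
    rw [hω']
    have : y₁ ^ 2 * P - y₀ * (m * y₁ * P) + (l + k) * (α * (y₀ + y₁)) * (y₀ * y₁)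
        = α ^ 2 * (y₁ ^ 2 - y₀ ^ 2) := by
      rw [hmL, hPe]; ring
    rw [← this]
    field_simp
  have hD : ω * y₁ * y₁ * QR + V₁ * (ω * (X * y₀)) * QR + V₁ * y₁ * (dQ * (ω * (X * y₀)))
      - (ω * (X * y₀) * y₀ * X * PR + V₀ * (ω * y₁) * X * PR
        + V₀ * y₀ * ((l + k) * X) * PR + V₀ * y₀ * X * (dP * (ω * y₁)))
      = ω * y₁ ^ 2 * m * PR * V₀ *
        ((1 / V₁ - m / V₀ + V₁ * dQ / (V₀ * PR) - dP / PR)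
          - (1 / y₀ - m / y₁ + (l + k) / (ω * y₁))) := by
    have hX' : X = m * y₁ / y₀ := by rw [hmX]; field_simp
    have hQ' : QR = m * V₀ * PR / V₁ := by rw [hmR]; field_simp
    rw [hX', hQ']
    field_simp
    ring
  rw [hD, hA1, hA2]
  have hy : 0 < y₁ + y₀ := by linarith
  refine mul_pos (by positivity) (sub_pos.2 ?_)
  rw [div_lt_div_iff₀ (by positivity) (by positivity)]
  have := mul_lt_mul_of_pos_left htan hy
  have hs : V₀ + V₁ = y₁ + y₀ := by rw [hV0e, hV1e]; ring
  have e : β ^ 2 * (V₀ ^ 2 - V₁ ^ 2) * (y₀ * y₁ ^ 2 * P) =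
    (V₀ + V₁) * (β ^ 2 * ((V₀ - V₁) * (y₀ * y₁ ^ 2 * P))) := by ring
  rw [e, hs]
  linarith

/-- Two half maps, one of them shifted by `b`, can be matched by at most one flight. -/
lemma half_flights_not_lt {α l k β σ ν b : ℝ} (hα : 0 < α) (hk : 0 < k)
    (hkl : k < l) (hβ : 0 < β) (hν : 0 < ν) (hνσ : ν < σ)
    (hc : 4 * (σ * ν) / (σ + ν) ^ 2 ≤ 4 * (l * k) / (l + k) ^ 2) (hb : 0 < b)
    {s₁ s₂ t₁ t₂ : ℝ} (hs₁ : 0 < s₁) (hs : s₁ < s₂) (ht₂ : 0 < t₂)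
    (h₁ : IsHalfFlight β σ ν t₁ (halfStart α l k s₁ - b) (halfEnd α l k s₁ + b))
    (h₂ : IsHalfFlight β σ ν t₂ (halfStart α l k s₂ - b) (halfEnd α l k s₂ + b)) : False := by
  have hl := hk.trans hkl
  have hσ := hν.trans hνσ
  set Y₀ := halfStart α l k with hY0
  set Y₁ := halfEnd α l k with hY1
  set ω : ℝ → ℝ := fun s => (l - k) / (Real.exp (l * s) - Real.exp (k * s)) with hωe
  set X : ℝ → ℝ := fun s => Real.exp ((l + k) * s) with hXe
  have hY0p : ∀ s, 0 < s → 0 < Y₀ s := fun s => halfStart_pos hα hk hkl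
  have hY1p : ∀ s, 0 < s → 0 < Y₁ s := fun s => halfEnd_pos hα hk hkl
  have hωp : ∀ s, 0 < s → 0 < ω s := fun s h => div_pos (by linarith) (exp_gap_pos hkl h)
  have hXp : ∀ s, 0 < X s := fun s => Real.exp_pos _
  have hdY0 : ∀ s, 0 < s → HasDerivAt Y₀ (ω s * Y₁ s) s := fun s => hasDerivAt_halfStart hk hkl
  have hdY1 : ∀ s, 0 < s → HasDerivAt Y₁ (ω s * (X s * Y₀ s)) s :=
    fun s => hasDerivAt_halfEnd hk hkl
  have hdX : ∀ s, HasDerivAt X ((l + k) * X s) s := fun s => hasDerivAt_exp_mul (l + k) s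
  have hσ2 : σ * (Y₀ s₂ - b) < β := by
    rw [((isHalfFlight_iff hν hνσ ht₂).1 h₂).1]; exact mul_halfStart_lt hβ hν hνσ ht₂
  have hv1 : ∀ s, 0 < s → s ≤ s₂ → 0 < β - σ * (Y₀ s - b) := by
    intro s h1 h2
    have : Y₀ s ≤ Y₀ s₂ := (halfStart_strictMonoOn hα hk hkl).monotoneOn (Set.mem_Ioi.2 h1)
      (Set.mem_Ioi.2 (h1.trans_le h2)) h2
    have : σ * (Y₀ s - b) ≤ σ * (Y₀ s₂ - b) := by gcongr
    linarith
  have hv2 : ∀ s, 0 < s → s ≤ s₂ → 0 < β - ν * (Y₀ s - b) := by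
    intro s h1 h2
    have := hv1 s h1 h2
    rcases le_or_gt (Y₀ s - b) 0 with h | h
    · nlinarith
    · have : ν * (Y₀ s - b) < σ * (Y₀ s - b) := by gcongr
      linarith
  have hw : ∀ c, 0 < c → ∀ s, 0 < s → 0 < β + c * (Y₁ s + b) := by
    intro c h s hs; have := hY1p s hs; positivity
  set E : ℝ → ℝ := fun s =>
    nodeIntegral β σ ν (Y₀ s - b) - nodeIntegral β σ ν (-(Y₁ s + b)) with hE
  set PR : ℝ → ℝ := fun s => (β - σ * (Y₀ s - b)) * (β - ν * (Y₀ s - b)) with hPR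
  set QR : ℝ → ℝ := fun s => (β + σ * (Y₁ s + b)) * (β + ν * (Y₁ s + b)) with hQR
  -- Right slope minus left slope, multiplied by `(Y₁ + b) * Y₁ * PR`.
  set Ψ : ℝ → ℝ := fun s =>
    (Y₀ s - b) * Y₁ s * QR s - (Y₁ s + b) * Y₀ s * X s * PR s with hΨ
  have hPRp : ∀ s, 0 < s → s ≤ s₂ → 0 < PR s := fun s h1 h2 => mul_pos (hv1 s h1 h2) (hv2 s h1 h2)
  have hQRp : ∀ s, 0 < s → 0 < QR s := fun s h1 => mul_pos (hw σ hσ s h1) (hw ν hν s h1)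
  have hdE : ∀ s, 0 < s → s ≤ s₂ →
      HasDerivAt E ((σ - ν) * ω s / (PR s * QR s) * Ψ s) s := by
    intro s h1 h2
    have e : ∀ c, β - c * -(Y₁ s + b) = β + c * (Y₁ s + b) := fun c => by ring
    have d1 := (hasDerivAt_nodeIntegral hν hνσ (hv1 s h1 h2) (hv2 s h1 h2)).comp s
      ((hdY0 s h1).sub_const b)
    have d2 := (hasDerivAt_nodeIntegral (v := -(Y₁ s + b)) hν hνσ
      (by rw [e]; exact hw σ hσ s h1) (by rw [e]; exact hw ν hν s h1)).comp s
      ((hdY1 s h1).add_const b).fun_neg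
    refine (d1.sub d2).congr_deriv ?_
    rw [e, e]
    have hp := hPRp s h1 h2
    have hq := hQRp s h1
    change (σ - ν) * (Y₀ s - b) / PR s * _ - (σ - ν) * -(Y₁ s + b) / QR s * _ = _
    simp only [hΨ]
    field_simp
  set dP : ℝ → ℝ := fun s => -(σ * (β - ν * (Y₀ s - b)) + ν * (β - σ * (Y₀ s - b))) with hdP
  set dQ : ℝ → ℝ := fun s => σ * (β + ν * (Y₁ s + b)) + ν * (β + σ * (Y₁ s + b)) with hdQ
  set Ψ' : ℝ → ℝ := fun s =>
    ω s * Y₁ s * Y₁ s * QR s + (Y₀ s - b) * (ω s * (X s * Y₀ s)) * QR s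
      + (Y₀ s - b) * Y₁ s * (dQ s * (ω s * (X s * Y₀ s)))
      - (ω s * (X s * Y₀ s) * Y₀ s * X s * PR s + (Y₁ s + b) * (ω s * Y₁ s) * X s * PR s
        + (Y₁ s + b) * Y₀ s * ((l + k) * X s) * PR s
        + (Y₁ s + b) * Y₀ s * X s * (dP s * (ω s * Y₁ s))) with hΨ'
  have hdΨ : ∀ s, 0 < s → HasDerivAt Ψ (Ψ' s) s := by
    intro s h
    have a0 := (hdY0 s h).sub_const b
    have a1 := (hdY1 s h).add_const b
    have dPR : HasDerivAt PR (dP s * (ω s * Y₁ s)) s := by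
      refine (((a0.const_mul σ).const_sub β).fun_mul
        ((a0.const_mul ν).const_sub β)).congr_deriv ?_
      simp only [hdP]; ring
    have dQR : HasDerivAt QR (dQ s * (ω s * (X s * Y₀ s))) s := by
      refine (((a1.const_mul σ).const_add β).fun_mul
        ((a1.const_mul ν).const_add β)).congr_deriv ?_
      simp only [hdQ]; ring
    refine (((a0.fun_mul (hdY1 s h)).fun_mul dQR).fun_sub
      (((a1.fun_mul (hdY0 s h)).fun_mul (hdX s)).fun_mul dPR)).congr_deriv ?_
    simp only [hΨ']; ring
  have hcross : ∀ s, 0 < s → s ≤ s₂ → b < Y₀ s → Ψ s = 0 → 0 < Ψ' s := by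
    intro s h1 h2 h3 h4
    have hP := halfStart_eigenproduct (α := α) hk hkl h1
    have hXP := halfEnd_eigenproduct (α := α) hk hkl h1
    exact slope_difference_deriv_pos hα hk hkl hβ hν hνσ hc hb h3
      (halfStart_lt_halfEnd hα hk hkl h1) (mul_halfStart_lt hα hk hkl h1)
      (by linarith [hv1 s h1 h2]) (hXp s) (hωp s h1) hP hXP rfl rfl rfl rfl h4
  have hΨneg : ∀ s, 0 < s → s ≤ s₂ → Y₀ s ≤ b → Ψ s < 0 := by
    intro s h1 h2 h3
    have q1 := hPRp s h1 h2
    have q2 := hQRp s h1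
    have q3 := hY0p s h1
    have q4 := hY1p s h1
    have q5 := hXp s
    have r1 : 0 < (Y₁ s + b) * Y₀ s * X s * PR s := by positivity
    have r2 : (Y₀ s - b) * (Y₁ s * QR s) ≤ 0 :=
      mul_nonpos_of_nonpos_of_nonneg (by linarith) (by positivity)
    simp only [hΨ]
    linarith
  have hE1 : E s₁ = 0 := sub_eq_zero.2 (h₁.nodeIntegral_eq hν hνσ (hv1 _ hs₁ hs.le) (hv2 _ hs₁ hs.le))
  have hs₂ := hs₁.trans hs
  have hE2 : E s₂ = 0 := sub_eq_zero.2 (h₂.nodeIntegral_eq hν hνσ (hv1 _ hs₂ le_rfl) (hv2 _ hs₂ le_rfl))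
  obtain ⟨s₀, hs₀, hs₀1, hs₀b⟩ : ∃ s₀, 0 < s₀ ∧ s₀ < s₁ ∧ Y₀ s₀ ≤ b := by
    have h0 : 0 < min (s₁ / 2) (b / α) := lt_min (by linarith) (by positivity)
    refine ⟨min (s₁ / 2) (b / α), h0, (min_le_left _ _).trans_lt (by linarith), ?_⟩
    refine (halfStart_lt hα hk hkl h0).le.trans ?_
    calc α * min (s₁ / 2) (b / α) ≤ α * (b / α) := by gcongr; exact min_le_right _ _
      _ = b := by field_simp
  have hE0 : E s₀ < 0 := by
    have q3 := hY0p s₀ hs₀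
    have q4 := hY1p s₀ hs₀
    refine sub_neg.2 (nodeIntegral_strictAntiOn hβ hν hνσ (Set.mem_Iic.2 ?_) (Set.mem_Iic.2 ?_) ?_)
      <;> linarith
  have hEc : ∀ a c, 0 < a → c ≤ s₂ → ContinuousOn E (Set.Icc a c) := fun a c ha hc x hx =>
    (hdE x (ha.trans_le hx.1) (hx.2.trans hc)).continuousAt.continuousWithinAt
  have hcoef : ∀ s, 0 < s → s ≤ s₂ → 0 < (σ - ν) * ω s / (PR s * QR s) := fun s h1 h2 =>
    div_pos (mul_pos (by linarith) (hωp s h1)) (mul_pos (hPRp s h1 h2) (hQRp s h1))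
  -- `E` rises from a negative value to `0` on `[s₀, s₁]`, so `Ψ > 0` at some `ξ₁`; Rolle on `[s₁,
  -- s₂]` gives a zero `ξ₂` of `Ψ`.
  obtain ⟨ξ₁, hξ₁, hξ₁'⟩ := exists_hasDerivAt_eq_slope E _ hs₀1 (hEc _ _ hs₀ hs.le)
    fun x hx => hdE x (hs₀.trans hx.1) (hx.2.le.trans hs.le)
  obtain ⟨ξ₂, hξ₂, hξ₂'⟩ := exists_hasDerivAt_eq_zero hs (hEc _ _ hs₁ le_rfl) (hE1.trans hE2.symm)
    fun x hx => hdE x (hs₁.trans hx.1) hx.2.le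
  have hξ₁0 := hs₀.trans hξ₁.1
  have hξ₁2 : ξ₁ ≤ s₂ := hξ₁.2.le.trans hs.le
  have hξ₂0 := hs₁.trans hξ₂.1
  have hΨ1 : 0 < Ψ ξ₁ := by
    have : 0 < (E s₁ - E s₀) / (s₁ - s₀) := div_pos (by linarith) (by linarith)
    rw [← hξ₁'] at this
    exact (mul_pos_iff_of_pos_left (hcoef _ hξ₁0 hξ₁2)).1 this
  have hΨ2 : Ψ ξ₂ = 0 := by
    rcases mul_eq_zero.1 hξ₂' with h | h
    · exact absurd h (hcoef _ hξ₂0 hξ₂.2.le).ne'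
    · exact h
  have hYb : ∀ s, ξ₁ ≤ s → b < Y₀ s := by
    intro s h
    have h1 : b < Y₀ ξ₁ := by
      by_contra! hle
      exact (hΨneg _ hξ₁0 hξ₁2 hle).not_gt hΨ1
    exact h1.trans_le ((halfStart_strictMonoOn hα hk hkl).monotoneOn (Set.mem_Ioi.2 hξ₁0)
      (Set.mem_Ioi.2 (hξ₁0.trans_le h)) h)
  -- Zeros of `Ψ` beyond `ξ₁` are crossed upwards only, so `Ψ` stays nonnegative. Then `ξ₂` is a
  -- local minimum, against `Ψ' > 0` there.
  have hnn : ∀ ⦃x⦄, x ∈ Set.Icc ξ₁ s₂ → -Ψ x ≤ 0 :=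
    image_le_of_deriv_right_lt_deriv_boundary' (f := fun x => -Ψ x) (f' := fun x => -Ψ' x)
      (B := fun _ => 0) (B' := fun _ => 0)
      (fun x hx => (hdΨ x (hξ₁0.trans_le hx.1)).continuousAt.neg.continuousWithinAt)
      (fun x hx => (hdΨ x (hξ₁0.trans_le hx.1)).neg.hasDerivWithinAt)
      (by simpa using hΨ1.le) continuousOn_const (fun x _ => hasDerivWithinAt_const _ _ _)
      (fun x hx h => by
        have := hcross x (hξ₁0.trans_le hx.1) hx.2.le (hYb x hx.1) (by simpa using h)
        simpa using this)
  have hlt : ξ₁ < ξ₂ := hξ₁.2.trans hξ₂.1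
  have hmin : IsLocalMin Ψ ξ₂ := by
    filter_upwards [Ioo_mem_nhds hlt hξ₂.2] with x hx
    have := hnn (Set.Ioo_subset_Icc_self hx)
    rw [hΨ2]; linarith
  have h0 := hmin.hasDerivAt_eq_zero (hdΨ _ hξ₂0)
  exact (hcross _ hξ₂0 hξ₂.2.le (hYb _ hlt.le) hΨ2).ne' h0

end NodeNode

/-! ### Flow in each zone and forward uniqueness -/

namespace NodeNode

open Set Filter Topology

section Scalar

lemma eventually_neg_after {f : ℝ → ℝ} {t d : ℝ} (h0 : f t = 0)
    (h : HasDerivWithinAt f d (Ici t) t) (hd : d < 0) : ∀ᶠ s in 𝓝[>] t, f s < 0 := by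
  have h1 := (hasDerivWithinAt_iff_tendsto_slope' self_notMem_Ioi).1 (h.mono Ioi_subset_Ici_self)
  filter_upwards [h1.eventually (gt_mem_nhds hd), self_mem_nhdsWithin] with s hs hts
  rw [slope_def_field, h0, sub_zero, div_neg_iff] at hs
  have : 0 < s - t := sub_pos.2 hts
  rcases hs with hs | hs <;> linarith [hs.1, hs.2]

lemma eventually_pos_before {f : ℝ → ℝ} {t d : ℝ} (h0 : f t = 0)
    (h : HasDerivWithinAt f d (Iic t) t) (hd : d < 0) : ∀ᶠ s in 𝓝[<] t, 0 < f s := by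
  have h1 := (hasDerivWithinAt_iff_tendsto_slope' self_notMem_Iio).1 (h.mono Iio_subset_Iic_self)
  filter_upwards [h1.eventually (gt_mem_nhds hd), self_mem_nhdsWithin] with s hs hts
  rw [slope_def_field, h0, sub_zero, div_neg_iff] at hs
  have : s - t < 0 := sub_neg.2 hts
  rcases hs with hs | hs <;> linarith [hs.1, hs.2]

/-- A function that leaves `0` downwards stays negative up to its next zero. -/
lemma exists_next_zero {f : ℝ → ℝ} (hf : Continuous f) {t₀ d T : ℝ} (h0 : f t₀ = 0)
    (h : HasDerivWithinAt f d (Ici t₀) t₀) (hd : d < 0) (hT : t₀ < T) (hfT : f T = 0) :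
    ∃ t₁, t₀ < t₁ ∧ f t₁ = 0 ∧ ∀ t ∈ Ioo t₀ t₁, f t < 0 := by
  obtain ⟨u, hu, hneg⟩ := mem_nhdsGT_iff_exists_Ioo_subset.1 (eventually_neg_after h0 h hd)
  have hu' : t₀ < u := hu
  obtain ⟨c, hc0, hcu⟩ := exists_between hu'
  have hTu : u ≤ T := by
    by_contra! hlt
    exact (hneg ⟨hT, hlt⟩ : f T < 0).ne hfT
  have hcpt : IsCompact (Icc c T ∩ f ⁻¹' {0}) :=
    isCompact_Icc.inter_right (isClosed_singleton.preimage hf)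
  obtain ⟨t₁, ⟨⟨h1, h2⟩, h3⟩, hmin⟩ := hcpt.exists_isLeast ⟨T, ⟨by linarith, le_rfl⟩, hfT⟩
  refine ⟨t₁, hc0.trans_le h1, h3, fun t ht => ?_⟩
  by_contra! hge
  have hut : u ≤ t := by
    by_contra! hlt
    exact (hneg ⟨ht.1, hlt⟩ : f t < 0).not_ge hge
  have hct : c ≤ t := hcu.le.trans hut
  obtain ⟨r, hr, hr0⟩ := intermediate_value_Icc hct hf.continuousOn
    ⟨(hneg ⟨hc0, hcu⟩ : f c < 0).le, hge⟩
  have := hmin ⟨⟨hr.1, hr.2.trans (ht.2.le.trans h2)⟩, hr0⟩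
  linarith [hr.2, ht.2]

/-- Right derivatives are used because a flight begins on the switching line, where the solution is
only one-sidedly differentiable. -/
lemma eq_exp_mul_of_hasDerivWithinAt {f : ℝ → ℝ} {a c r : ℝ} (hf : ContinuousOn f (Icc a c))
    (h : ∀ t ∈ Ico a c, HasDerivWithinAt f (r * f t) (Ici t) t) :
    ∀ t ∈ Icc a c, f t = Real.exp (r * (t - a)) * f a := by
  intro t ht
  have hexp : ∀ t, HasDerivAt (fun t => Real.exp (-(r * (t - a))))
      (Real.exp (-(r * (t - a))) * -r) t := fun t => by
    simpa using ((((hasDerivAt_id' t).sub_const a).const_mul r).fun_neg).exp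
  have hconst := constant_of_has_deriv_right_zero (f := fun t => Real.exp (-(r * (t - a))) * f t)
    (a := a) (b := c) (ContinuousOn.mul (by fun_prop) hf) (fun t ht => by
      refine ((hexp t).hasDerivWithinAt.fun_mul (h t ht)).congr_deriv ?_
      ring) t ht
  simp only [sub_self, mul_zero, neg_zero, Real.exp_zero, one_mul] at hconst
  rw [← hconst, ← mul_assoc, ← Real.exp_add, add_neg_cancel, Real.exp_zero, one_mul]

end Scalar

lemma HasDerivWithinAt.fst' {z : ℝ → ℝ × ℝ} {v : ℝ × ℝ} {s : Set ℝ} {t : ℝ}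
    (h : HasDerivWithinAt z v s t) : HasDerivWithinAt (fun t => (z t).1) v.1 s t :=
  (hasFDerivAt_fst (𝕜 := ℝ) (p := z t)).comp_hasDerivWithinAt t h

lemma HasDerivWithinAt.snd' {z : ℝ → ℝ × ℝ} {v : ℝ × ℝ} {s : Set ℝ} {t : ℝ}
    (h : HasDerivWithinAt z v s t) : HasDerivWithinAt (fun t => (z t).2) v.2 s t :=
  (hasFDerivAt_snd (𝕜 := ℝ) (p := z t)).comp_hasDerivWithinAt t h

section Runs

variable {p : Params} {z : ℝ → ℝ × ℝ} {a c : ℝ}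

/-- `z` follows the vector field `F` on the time interval `[a, c]`. -/
def Follows (F : ℝ × ℝ → ℝ × ℝ) (z : ℝ → ℝ × ℝ) (a c : ℝ) : Prop :=
  ContinuousOn z (Icc a c) ∧ ∀ t ∈ Ico a c, HasDerivWithinAt z (F (z t)) (Ici t) t

/-- The condition on `r` is the characteristic equation; on `x = 0` this eigencoordinate becomes `αL
- r * y`. -/
lemma Follows.left_eigen (h : Follows (leftField p) z a c) {r : ℝ} (hr : (r - p.γL) ^ 2 = 1) :
    ∀ t ∈ Icc a c, p.αL - r * (z t).2 + r ^ 2 * (z t).1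
      = Real.exp (r * (t - a)) * (p.αL - r * (z a).2 + r ^ 2 * (z a).1) := by
  refine eq_exp_mul_of_hasDerivWithinAt
    (f := fun t => p.αL - r * (z t).2 + r ^ 2 * (z t).1) ?_ fun t ht => ?_
  · exact (continuousOn_const.sub (continuousOn_const.mul h.1.snd)).add
      (continuousOn_const.mul h.1.fst)
  · have h1 := h.2 t ht
    refine (((HasDerivWithinAt.snd' h1).const_mul r).const_sub p.αL |>.fun_add
      ((HasDerivWithinAt.fst' h1).const_mul (r ^ 2))).congr_deriv ?_
    simp only [leftField]
    linear_combination (-r * (z t).1) * hr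

lemma Follows.right_eigen (h : Follows (rightField p) z a c) {r : ℝ} (hr : (r - p.γR) ^ 2 = 1) :
    ∀ t ∈ Icc a c, p.αR - r * ((z t).2 - p.b) + r ^ 2 * (z t).1
      = Real.exp (r * (t - a)) * (p.αR - r * ((z a).2 - p.b) + r ^ 2 * (z a).1) := by
  refine eq_exp_mul_of_hasDerivWithinAt
    (f := fun t => p.αR - r * ((z t).2 - p.b) + r ^ 2 * (z t).1) ?_ fun t ht => ?_
  · exact (continuousOn_const.sub (continuousOn_const.mul (h.1.snd.sub continuousOn_const))).add
      (continuousOn_const.mul h.1.fst)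
  · have h1 := h.2 t ht
    refine ((((HasDerivWithinAt.snd' h1).sub_const p.b).const_mul r).const_sub p.αR |>.fun_add
      ((HasDerivWithinAt.fst' h1).const_mul (r ^ 2))).congr_deriv ?_
    simp only [rightField]
    linear_combination (-r * (z t).1) * hr

/-- The two eigenvalues are distinct and nonzero, so the two eigencoordinates determine the point.
-/
lemma Follows.left_unique (h : Follows (leftField p) z a c) {w : ℝ → ℝ × ℝ}
    (hw : Follows (leftField p) w a c) (hγ : 1 < |p.γL|) (hzw : z a = w a) :
    ∀ t ∈ Icc a c, z t = w t := by
  intro t ht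
  have h1 := h.left_eigen (r := p.γL + 1) (by ring) t ht
  have h2 := h.left_eigen (r := p.γL - 1) (by ring) t ht
  have w1 := hw.left_eigen (r := p.γL + 1) (by ring) t ht
  have w2 := hw.left_eigen (r := p.γL - 1) (by ring) t ht
  rw [hzw, ← w1] at h1
  rw [hzw, ← w2] at h2
  have n1 : p.γL + 1 ≠ 0 := by
    intro h0; rw [eq_neg_of_add_eq_zero_left h0] at hγ; norm_num at hγ
  have n2 : p.γL - 1 ≠ 0 := by
    intro h0; rw [sub_eq_zero.1 h0] at hγ; norm_num at hγ
  have e1 : (p.γL + 1) * ((z t).1 - (w t).1) = (z t).2 - (w t).2 :=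
    mul_left_cancel₀ n1 (by linear_combination h1)
  have e2 : (p.γL - 1) * ((z t).1 - (w t).1) = (z t).2 - (w t).2 :=
    mul_left_cancel₀ n2 (by linear_combination h2)
  have e3 : (z t).1 = (w t).1 := by linear_combination (e1 - e2) / 2
  exact Prod.ext e3 (by rw [e3] at e1; linear_combination -e1)

lemma Follows.right_unique (h : Follows (rightField p) z a c) {w : ℝ → ℝ × ℝ}
    (hw : Follows (rightField p) w a c) (hγ : 1 < |p.γR|) (hzw : z a = w a) :
    ∀ t ∈ Icc a c, z t = w t := by
  intro t ht
  have h1 := h.right_eigen (r := p.γR + 1) (by ring) t ht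
  have h2 := h.right_eigen (r := p.γR - 1) (by ring) t ht
  have w1 := hw.right_eigen (r := p.γR + 1) (by ring) t ht
  have w2 := hw.right_eigen (r := p.γR - 1) (by ring) t ht
  rw [hzw, ← w1] at h1
  rw [hzw, ← w2] at h2
  have n1 : p.γR + 1 ≠ 0 := by
    intro h0; rw [eq_neg_of_add_eq_zero_left h0] at hγ; norm_num at hγ
  have n2 : p.γR - 1 ≠ 0 := by
    intro h0; rw [sub_eq_zero.1 h0] at hγ; norm_num at hγ
  have e1 : (p.γR + 1) * ((z t).1 - (w t).1) = (z t).2 - (w t).2 :=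
    mul_left_cancel₀ n1 (by linear_combination h1)
  have e2 : (p.γR - 1) * ((z t).1 - (w t).1) = (z t).2 - (w t).2 :=
    mul_left_cancel₀ n2 (by linear_combination h2)
  have e3 : (z t).1 = (w t).1 := by linear_combination (e1 - e2) / 2
  exact Prod.ext e3 (by rw [e3] at e1; linear_combination -e1)

end Runs

namespace IsCrossingSolution

variable {p : Params} {z w : ℝ → ℝ × ℝ}

lemma shift (hz : IsCrossingSolution p z) (r : ℝ) : IsCrossingSolution p fun t => z (t + r) where
  left t h := (hz.left (t + r) h).comp_add_const t r
  right t h := (hz.right (t + r) h).comp_add_const t r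
  switch t h := by
    have key : ∀ {v : ℝ × ℝ} {S : Set ℝ}, HasDerivWithinAt z v S (t + r) →
        HasDerivWithinAt (fun t => z (t + r)) v ((fun t => t + r) ⁻¹' S) t := by
      intro v S hS
      have := hS.scomp t ((hasDerivAt_id' t).add_const r).hasDerivWithinAt (mapsTo_preimage _ S)
      rw [one_smul] at this
      exact this
    have hI : (fun t => t + r) ⁻¹' Iic (t + r) = Iic t := by ext; simp
    have hC : (fun t => t + r) ⁻¹' Ici (t + r) = Ici t := by ext; simp
    rcases hz.switch (t + r) h with ⟨h1, h2, h3, h4⟩ | ⟨h1, h2, h3, h4⟩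
    · exact Or.inl ⟨h1, h2, hI ▸ key h3, hC ▸ key h4⟩
    · exact Or.inr ⟨h1, h2, hI ▸ key h3, hC ▸ key h4⟩

lemma continuous (hz : IsCrossingSolution p z) : Continuous z := by
  rw [continuous_iff_continuousAt]
  intro t
  rcases lt_trichotomy (z t).1 0 with h | h | h
  · exact (hz.left t h).continuousAt
  · rcases hz.switch t h with ⟨-, -, h3, h4⟩ | ⟨-, -, h3, h4⟩ <;>
      exact continuousAt_iff_continuous_left_right.2
        ⟨h3.continuousWithinAt, h4.continuousWithinAt⟩
  · exact (hz.right t h).continuousAt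

lemma left_or_right (hz : IsCrossingSolution p z) (t : ℝ) :
    ((z t).1 < 0 ∨ (z t).1 = 0 ∧ 0 < (z t).2) ∨ (0 < (z t).1 ∨ (z t).1 = 0 ∧ (z t).2 < 0) := by
  rcases lt_trichotomy (z t).1 0 with h | h | h
  · exact .inl (.inl h)
  · rcases hz.switch t h with ⟨h1, -⟩ | ⟨h1, -⟩
    · exact .inl (.inr ⟨h, by simpa [leftField, h] using h1⟩)
    · exact .inr (.inr ⟨h, by simpa [leftField, h] using h1⟩)
  · exact .inr (.inl h)

lemma switch_down (hz : IsCrossingSolution p z) {t : ℝ} (h : (z t).1 = 0) (h' : 0 < (z t).2) :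
    HasDerivWithinAt z (leftField p (z t)) (Ici t) t := by
  rcases hz.switch t h with ⟨-, -, -, h4⟩ | ⟨h1, -⟩
  · exact h4
  · simp only [leftField, h] at h1; linarith

lemma switch_up (hz : IsCrossingSolution p z) {t : ℝ} (h : (z t).1 = 0) (h' : (z t).2 < 0) :
    HasDerivWithinAt z (rightField p (z t)) (Ici t) t := by
  rcases hz.switch t h with ⟨h1, -⟩ | ⟨-, -, -, h4⟩
  · simp only [leftField, h] at h1; linarith
  · exact h4

lemma follows_left (hz : IsCrossingSolution p z) {a c : ℝ}
    (ha : (z a).1 < 0 ∨ (z a).1 = 0 ∧ 0 < (z a).2) (hac : ∀ t ∈ Ioo a c, (z t).1 < 0) :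
    Follows (leftField p) z a c := by
  refine ⟨hz.continuous.continuousOn, fun t ht => ?_⟩
  rcases ht.1.eq_or_lt with rfl | hlt
  · rcases ha with h | h
    · exact (hz.left _ h).hasDerivWithinAt
    · exact (hz.switch_down h.1 h.2)
  · exact (hz.left t (hac t ⟨hlt, ht.2⟩)).hasDerivWithinAt

lemma follows_right (hz : IsCrossingSolution p z) {a c : ℝ}
    (ha : 0 < (z a).1 ∨ (z a).1 = 0 ∧ (z a).2 < 0) (hac : ∀ t ∈ Ioo a c, 0 < (z t).1) :
    Follows (rightField p) z a c := by
  refine ⟨hz.continuous.continuousOn, fun t ht => ?_⟩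
  rcases ht.1.eq_or_lt with rfl | hlt
  · rcases ha with h | h
    · exact (hz.right _ h).hasDerivWithinAt
    · exact (hz.switch_up h.1 h.2)
  · exact (hz.right t (hac t ⟨hlt, ht.2⟩)).hasDerivWithinAt

lemma eventually_left (hz : IsCrossingSolution p z) {t : ℝ}
    (h : (z t).1 < 0 ∨ (z t).1 = 0 ∧ 0 < (z t).2) : ∀ᶠ s in 𝓝[>] t, (z s).1 < 0 := by
  rcases h with h | h
  · exact (hz.continuous.fst.continuousAt.eventually (gt_mem_nhds h)).filter_mono
      nhdsWithin_le_nhds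
  · refine eventually_neg_after h.1 (HasDerivWithinAt.fst' (hz.switch_down h.1 h.2)) ?_
    simp only [leftField, h.1]; linarith [h.2]

lemma eventually_right (hz : IsCrossingSolution p z) (hb : 0 < p.b) {t : ℝ}
    (h : 0 < (z t).1 ∨ (z t).1 = 0 ∧ (z t).2 < 0) : ∀ᶠ s in 𝓝[>] t, 0 < (z s).1 := by
  rcases h with h | h
  · exact (hz.continuous.fst.continuousAt.eventually (lt_mem_nhds h)).filter_mono
      nhdsWithin_le_nhds
  · have := eventually_neg_after (f := fun s => -(z s).1) (by simp [h.1])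
      (HasDerivWithinAt.fst' (hz.switch_up h.1 h.2)).neg
      (by simp only [rightField, h.1]; linarith [h.2])
    simpa using this

/-- Crossing solutions are determined forwards in time by their initial value. -/
lemma forward_unique (hz : IsCrossingSolution p z) (hw : IsCrossingSolution p w)
    (hp : p.Admissible) (hb : 0 < p.b) (h0 : z 0 = w 0) {t : ℝ} (ht : 0 ≤ t) : z t = w t := by
  have hclosed : IsClosed ({t | z t = w t} ∩ Icc 0 t) :=
    (isClosed_eq hz.continuous hw.continuous).inter isClosed_Icc
  -- Continuation: from any time of agreement both solutions enter the same zone and follow its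
  -- field for a while.
  refine hclosed.Icc_subset_of_forall_exists_gt h0 ?_ (right_mem_Icc.2 ht)
  rintro x ⟨hx, -⟩ y hy
  have hx' : z x = w x := hx
  have hy' : x < y := hy
  rcases hz.left_or_right x with h | h
  · obtain ⟨u, hu, hsub⟩ := mem_nhdsGT_iff_exists_Ioo_subset.1
      ((hz.eventually_left h).and (hw.eventually_left (hx' ▸ h)))
    have hu' : x < u := hu
    refine ⟨min u y, ?_, lt_min hu' hy', min_le_right _ _⟩
    exact (hz.follows_left h fun t ht => (hsub ht).1).left_unique
      (hw.follows_left (hx' ▸ h) fun t ht => (hsub ht).2) hp.1 hx' _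
      ⟨(lt_min hu' hy').le, min_le_left _ _⟩
  · obtain ⟨u, hu, hsub⟩ := mem_nhdsGT_iff_exists_Ioo_subset.1
      ((hz.eventually_right hb h).and (hw.eventually_right hb (hx' ▸ h)))
    have hu' : x < u := hu
    refine ⟨min u y, ?_, lt_min hu' hy', min_le_right _ _⟩
    exact (hz.follows_right h fun t ht => (hsub ht).1).right_unique
      (hw.follows_right (hx' ▸ h) fun t ht => (hsub ht).2) hp.2.1 hx' _
      ⟨(lt_min hu' hy').le, min_le_left _ _⟩

/-- Periodicity moves any time of `z` beyond `s`, so forward uniqueness suffices. -/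
lemma range_subset (hz : IsCrossingSolution p z) (hw : IsCrossingSolution p w)
    (hp : p.Admissible) (hb : 0 < p.b) {T : ℝ} (hT : 0 < T) (hper : Function.Periodic z T)
    {s t : ℝ} (h : z s = w t) : range z ⊆ range w := by
  rintro _ ⟨x, rfl⟩
  obtain ⟨y, hy, hxy⟩ := hper.exists_mem_Ico hT x s
  have := (hz.shift s).forward_unique (hw.shift t) hp hb (by simpa using h)
    (sub_nonneg.2 hy.1)
  rw [hxy]
  exact ⟨y - s + t, by simpa using this.symm⟩

end IsCrossingSolution

end NodeNode

/-! ### Flights of a periodic solution and its return map -/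

namespace NodeNode

open Set Filter Topology

namespace IsCrossingSolution

variable {p : Params} {z w : ℝ → ℝ × ℝ}

/-- The flight through the left half plane that follows a downward crossing. -/
lemma next_left (hz : IsCrossingSolution p z) {t₀ T : ℝ} (h0 : (z t₀).1 = 0)
    (hy : 0 < (z t₀).2) (hT : t₀ < T) (hzT : (z T).1 = 0) :
    ∃ t₁, t₀ < t₁ ∧ (z t₁).1 = 0 ∧ (z t₁).2 < 0 ∧
      IsHalfFlight p.αL (p.γL + 1) (p.γL - 1) (t₁ - t₀) (z t₀).2 (-(z t₁).2) := by
  obtain ⟨t₁, h1, hz1, hneg⟩ := exists_next_zero hz.continuous.fst h0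
    (HasDerivWithinAt.fst' (hz.switch_down h0 hy))
    (by simp only [leftField, h0]; linarith) hT hzT
  have hrun := hz.follows_left (.inr ⟨h0, hy⟩) hneg
  refine ⟨t₁, h1, hz1, ?_, ?_, ?_⟩
  -- A downward crossing at `t₁` would force `x > 0` just before.
  · rcases hz.switch t₁ hz1 with ⟨-, h3, h4, -⟩ | ⟨h3, -⟩
    · obtain ⟨s, hs, hs'⟩ := ((eventually_pos_before hz1 (HasDerivWithinAt.fst' h4) h3).and
        (Ioo_mem_nhdsLT h1)).exists
      exact absurd hs (hneg s hs').not_gt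
    · simp only [leftField, hz1] at h3; linarith
  · have := hrun.left_eigen (r := p.γL + 1) (by ring) t₁ (right_mem_Icc.2 h1.le)
    rw [h0, hz1] at this
    linear_combination this
  · have := hrun.left_eigen (r := p.γL - 1) (by ring) t₁ (right_mem_Icc.2 h1.le)
    rw [h0, hz1] at this
    linear_combination this

/-- The flight through the right half plane that follows an upward crossing, in reversed time. -/
lemma next_right (hz : IsCrossingSolution p z) (hb : 0 < p.b) {t₀ T : ℝ} (h0 : (z t₀).1 = 0)
    (hy : (z t₀).2 < 0) (hT : t₀ < T) (hzT : (z T).1 = 0) :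
    ∃ t₁, t₀ < t₁ ∧ (z t₁).1 = 0 ∧ p.b < (z t₁).2 ∧
      IsHalfFlight (-p.αR) (1 - p.γR) (-1 - p.γR) (t₁ - t₀) ((z t₁).2 - p.b)
        (-(z t₀).2 + p.b) := by
  obtain ⟨t₁, h1, hz1, hneg⟩ := exists_next_zero (f := fun t => -(z t).1) hz.continuous.fst.neg
    (by simp [h0]) (HasDerivWithinAt.fst' (hz.switch_up h0 hy)).neg
    (by simp only [rightField, h0]; linarith) hT (by simp [hzT])
  have hpos : ∀ t ∈ Ioo t₀ t₁, 0 < (z t).1 := fun t ht => neg_lt_zero.1 (hneg t ht)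
  have hz1' : (z t₁).1 = 0 := neg_eq_zero.1 hz1
  have hrun := hz.follows_right (.inr ⟨h0, hy⟩) hpos
  have hexp : ∀ r x y : ℝ, x = Real.exp (r * (t₁ - t₀)) * y →
      Real.exp (-r * (t₁ - t₀)) * x = y := by
    intro r x y h
    rw [h, ← mul_assoc, ← Real.exp_add, neg_mul, neg_add_cancel, Real.exp_zero, one_mul]
  refine ⟨t₁, h1, hz1', ?_, ?_, ?_⟩
  · rcases hz.switch t₁ hz1' with ⟨-, h3, -, -⟩ | ⟨h3, -, h4, -⟩
    · simp only [rightField, hz1'] at h3; linarith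
    · obtain ⟨s, hs, hs'⟩ := ((eventually_pos_before (f := fun t => -(z t).1) hz1
        (HasDerivWithinAt.fst' h4).neg (by linarith)).and (Ioo_mem_nhdsLT h1)).exists
      have := hpos s hs'
      linarith
  · have := hexp _ _ _ (hrun.right_eigen (r := p.γR - 1) (by ring) t₁ (right_mem_Icc.2 h1.le))
    rw [h0, hz1', neg_sub] at this
    linear_combination this
  · have := hexp _ _ _ (hrun.right_eigen (r := p.γR + 1) (by ring) t₁ (right_mem_Icc.2 h1.le))
    rw [h0, hz1', (by ring : -(p.γR + 1) = -1 - p.γR)] at this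
    linear_combination this

/-- Within one zone, periodicity forces both eigencoordinates to vanish, which puts the point at the
equilibrium; that equilibrium lies in the opposite half plane. -/
lemma exists_zero_of_periodic (hz : IsCrossingSolution p z) (hp : p.Admissible) {T : ℝ}
    (hT : 0 < T) (hper : Function.Periodic z T) : ∃ t, (z t).1 = 0 := by
  by_contra! hne
  have hsign : (∀ t, (z t).1 < 0) ∨ ∀ t, 0 < (z t).1 := by
    by_contra! h
    obtain ⟨⟨s, hs⟩, t, ht⟩ := h
    obtain ⟨u, hu⟩ := mem_range_of_exists_le_of_exists_ge hz.continuous.fst ⟨t, ht⟩ ⟨s, hs⟩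
    exact hne u hu
  have hzT : z T = z 0 := by simpa using hper 0
  have hfix : ∀ r x : ℝ, r ≠ 0 → x = Real.exp (r * (T - 0)) * x → x = 0 := by
    intro r x hr h
    by_contra hx
    have h1 : Real.exp (r * (T - 0)) = 1 := mul_right_cancel₀ hx (by rw [one_mul, ← h])
    rw [Real.exp_eq_one_iff, sub_zero] at h1
    exact (mul_ne_zero hr hT.ne') h1
  have hn : ∀ g : ℝ, 1 < |g| → g + 1 ≠ 0 ∧ g - 1 ≠ 0 ∧ 0 < g ^ 2 - 1 := by
    intro g hg
    have h1 : 1 < g ^ 2 := by rw [← sq_abs]; exact one_lt_pow₀ hg two_ne_zero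
    refine ⟨fun h => ?_, fun h => ?_, by linarith⟩ <;> nlinarith
  obtain ⟨hγL, hγR, hαL, hαR⟩ := hp
  rcases hsign with h | h
  · obtain ⟨n1, n2, n3⟩ := hn _ hγL
    have hrun := hz.follows_left (a := 0) (c := T) (.inl (h 0)) fun t _ => h t
    have h1 := hrun.left_eigen (r := p.γL + 1) (by ring) T (right_mem_Icc.2 hT.le)
    have h2 := hrun.left_eigen (r := p.γL - 1) (by ring) T (right_mem_Icc.2 hT.le)
    rw [hzT] at h1 h2
    have e1 := hfix _ _ n1 h1
    have e2 := hfix _ _ n2 h2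
    have : (p.γL ^ 2 - 1) * (z 0).1 = p.αL := by
      linear_combination ((p.γL - 1) * e1 - (p.γL + 1) * e2) / 2
    nlinarith [h 0]
  · obtain ⟨n1, n2, n3⟩ := hn _ hγR
    have hrun := hz.follows_right (a := 0) (c := T) (.inl (h 0)) fun t _ => h t
    have h1 := hrun.right_eigen (r := p.γR + 1) (by ring) T (right_mem_Icc.2 hT.le)
    have h2 := hrun.right_eigen (r := p.γR - 1) (by ring) T (right_mem_Icc.2 hT.le)
    rw [hzT] at h1 h2
    have e1 := hfix _ _ n1 h1
    have e2 := hfix _ _ n2 h2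
    have : (p.γR ^ 2 - 1) * (z 0).1 = p.αR := by
      linear_combination ((p.γR - 1) * e1 - (p.γR + 1) * e2) / 2
    nlinarith [h 0]

lemma eventually_ne_zero (hz : IsCrossingSolution p z) {t : ℝ}
    (h : (z t).1 = 0) : ∀ᶠ s in 𝓝[≠] t, (z s).1 ≠ 0 := by
  rw [← Iio_union_Ioi, nhdsWithin_union, eventually_sup]
  rcases hz.switch t h with ⟨h1, h2, h3, h4⟩ | ⟨h1, h2, h3, h4⟩
  · exact ⟨(eventually_pos_before h (HasDerivWithinAt.fst' h3) h2).mono fun s hs => hs.ne',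
      (eventually_neg_after h (HasDerivWithinAt.fst' h4) h1).mono fun s hs => hs.ne⟩
  · exact ⟨(eventually_pos_before (f := fun s => -(z s).1) (by simp [h])
        (HasDerivWithinAt.fst' h3).neg (neg_lt_zero.2 h1)).mono fun s hs => by
          intro h0; simp [h0] at hs,
      (eventually_neg_after (f := fun s => -(z s).1) (by simp [h])
        (HasDerivWithinAt.fst' h4).neg (neg_lt_zero.2 h2)).mono fun s hs => by
          intro h0; simp [h0] at hs⟩

/-- Crossings are transversal, hence isolated, and a compact interval contains finitely many. -/
lemma finite_crossings (hz : IsCrossingSolution p z) (a c : ℝ) :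
    (Icc a c ∩ {t | (z t).1 = 0}).Finite := by
  by_contra hinf
  obtain ⟨t, ht, hacc⟩ := Set.Infinite.exists_accPt_of_subset_isCompact hinf
    (isCompact_Icc.inter_right (isClosed_singleton.preimage hz.continuous.fst)) subset_rfl
  have hev := hz.eventually_ne_zero ht.2
  obtain ⟨s, hs, hs'⟩ := ((accPt_iff_frequently_nhdsNE.1 hacc).and_eventually hev).exists
  exact hs' hs.2

/-- The heights of the downward crossings. -/
def downHeights (p : Params) (z : ℝ → ℝ × ℝ) : Set ℝ := {y | p.b < y ∧ (0, y) ∈ range z}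

lemma finite_downHeights (hz : IsCrossingSolution p z) {T : ℝ} (hT : 0 < T)
    (hper : Function.Periodic z T) : (downHeights p z).Finite := by
  refine ((hz.finite_crossings 0 T).image fun t => (z t).2).subset ?_
  rintro y ⟨-, x, hx⟩
  obtain ⟨t, ht, hxt⟩ := hper.exists_mem_Ico₀ hT x
  rw [hx] at hxt
  exact ⟨t, ⟨Ico_subset_Icc_self ht, by simp [← hxt]⟩, by simp [← hxt]⟩

/-- The return map at a downward crossing. -/
lemma exists_return (hz : IsCrossingSolution p z) (hb : 0 < p.b) {T : ℝ} (hT : 0 < T)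
    (hper : Function.Periodic z T) {y : ℝ} (hy : y ∈ downHeights p z) :
    ∃ y' ∈ downHeights p z, ∃ v s t, 0 < s ∧ 0 < t ∧
      IsHalfFlight p.αL (p.γL + 1) (p.γL - 1) s y v ∧
      IsHalfFlight (-p.αR) (1 - p.γR) (-1 - p.γR) t (y' - p.b) (v + p.b) := by
  obtain ⟨hyb, t₀, ht₀⟩ := hy
  have hzero : ∀ t, (z t).1 = 0 → (z (t + T)).1 = 0 := fun t h => by rw [hper t, h]
  have h0 : (z t₀).1 = 0 := by rw [ht₀]
  obtain ⟨t₁, h1, hz1, hy1, hf1⟩ := hz.next_left h0 (by rw [ht₀]; exact hb.trans hyb)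
    (lt_add_of_pos_right t₀ hT) (hzero _ h0)
  obtain ⟨t₂, h2, hz2, hy2, hf2⟩ := hz.next_right hb hz1 hy1
    (lt_add_of_pos_right t₁ hT) (hzero _ hz1)
  refine ⟨(z t₂).2, ⟨hy2, t₂, Prod.ext hz2 rfl⟩, -(z t₁).2, t₁ - t₀, t₂ - t₁,
    sub_pos.2 h1, sub_pos.2 h2, ?_, hf2⟩
  rwa [ht₀] at hf1

lemma downHeights_nonempty (hz : IsCrossingSolution p z) (hp : p.Admissible) (hb : 0 < p.b)
    {T : ℝ} (hT : 0 < T) (hper : Function.Periodic z T) : (downHeights p z).Nonempty := by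
  obtain ⟨t, ht⟩ := hz.exists_zero_of_periodic hp hT hper
  rcases hz.switch t ht with ⟨-, h, -, -⟩ | ⟨h, -, -, -⟩
  · refine ⟨(z t).2, ?_, t, Prod.ext ht rfl⟩
    simp only [rightField, ht] at h; linarith
  · obtain ⟨t₁, -, h1, h2, -⟩ := hz.next_right hb ht (by simp only [leftField, ht] at h; linarith)
      (lt_add_of_pos_right t hT) (by rw [hper t, ht])
    exact ⟨(z t₁).2, h2, t₁, Prod.ext h1 rfl⟩

end IsCrossingSolution

/-! ### One-turn closure and uniqueness of the periodic orbit -/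

open IsCrossingSolution

/-- A periodic crossing solution closes up after one turn. -/
lemma exists_closed_turn {p : Params} (hp : p.Admissible) (hL : 0 < p.γL) (hR : p.γR < 0)
    (hb : 0 < p.b) {z : ℝ → ℝ × ℝ} (hz : IsCrossingSolution p z) {T : ℝ} (hT : 0 < T)
    (hper : Function.Periodic z T) :
    ∃ s t r, 0 < s ∧ 0 < t ∧ z r = (0, halfStart p.αL (p.γL + 1) (p.γL - 1) s) ∧
      IsHalfFlight (-p.αR) (1 - p.γR) (-1 - p.γR) t
        (halfStart p.αL (p.γL + 1) (p.γL - 1) s - p.b)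
        (halfEnd p.αL (p.γL + 1) (p.γL - 1) s + p.b) := by
  obtain ⟨hγL, hγR, hαL, hαR⟩ := id hp
  rw [abs_of_pos hL] at hγL
  rw [abs_of_neg hR] at hγR
  have hk : 0 < p.γL - 1 := by linarith
  have hkl : p.γL - 1 < p.γL + 1 := by linarith
  have hβ : 0 < -p.αR := by linarith
  have hν : 0 < -1 - p.γR := by linarith
  have hνσ : -1 - p.γR < 1 - p.γR := by linarith
  have hret := fun y : downHeights p z => hz.exists_return hb hT hper y.2
  choose f hf v s t hs ht hfl hfr using hret
  -- The return map is a composite of increasing half maps; on the finite set of downward heights a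
  -- strictly increasing self-map is the identity.
  have hmono : StrictMono fun y => (⟨f y, hf y⟩ : downHeights p z) := by
    intro y y' hyy
    have hyy' : (y : ℝ) < y' := hyy
    have a1 := (isHalfFlight_iff hk hkl (hs y)).1 (hfl y)
    have a2 := (isHalfFlight_iff hk hkl (hs y')).1 (hfl y')
    have b1 := (isHalfFlight_iff hν hνσ (ht y)).1 (hfr y)
    have b2 := (isHalfFlight_iff hν hνσ (ht y')).1 (hfr y')
    rw [a1.1, a2.1, (halfStart_strictMonoOn hαL hk hkl).lt_iff_lt (hs y) (hs y')] at hyy'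
    have hv : v y < v y' := by
      rw [a1.2, a2.2]; exact halfEnd_strictMonoOn hαL hk hkl (hs y) (hs y') hyy'
    have hv' : v y + p.b < v y' + p.b := by linarith
    rw [b1.2, b2.2, (halfEnd_strictMonoOn hβ hν hνσ).lt_iff_lt (ht y) (ht y')] at hv'
    have := halfStart_strictMonoOn hβ hν hνσ (ht y) (ht y') hv'
    rw [← b1.1, ← b2.1] at this
    exact Subtype.mk_lt_mk.2 (by linarith)
  have := (hz.finite_downHeights hT hper).to_subtype
  obtain ⟨y, hy⟩ := hz.downHeights_nonempty hp hb hT hper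
  obtain ⟨r, hr⟩ := hy.2
  have hfix : f ⟨y, hy⟩ = y := by
    have h1 : y ≤ f ⟨y, hy⟩ := hmono.le_apply (x := ⟨y, hy⟩)
    have h2 : f ⟨y, hy⟩ ≤ y := hmono.apply_le (x := ⟨y, hy⟩)
    exact le_antisymm h2 h1
  obtain ⟨e1, e2⟩ := (isHalfFlight_iff hk hkl (hs ⟨y, hy⟩)).1 (hfl ⟨y, hy⟩)
  have e1' : y = _ := e1
  refine ⟨s ⟨y, hy⟩, t ⟨y, hy⟩, r, hs _, ht _, by rw [hr, ← e1], ?_⟩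
  have := hfr ⟨y, hy⟩
  rw [hfix, e2] at this
  rwa [← e1']

/-- There is at most one crossing periodic orbit. -/
theorem crossingPeriodicOrbit_unique {p : Params} (hp : p.Admissible) (hL : 0 < p.γL)
    (hR : p.γR < 0) (hb : 0 < p.b) (hsum : 0 < p.γL + p.γR) {Γ Γ' : Set (ℝ × ℝ)}
    (h : IsCrossingPeriodicOrbit p Γ) (h' : IsCrossingPeriodicOrbit p Γ') : Γ = Γ' := by
  obtain ⟨z, hz, ⟨T, hT, hper⟩, -, rfl⟩ := h
  obtain ⟨z', hz', ⟨T', hT', hper'⟩, -, rfl⟩ := h'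
  obtain ⟨s, t, r, hs, ht, hr, hf⟩ := exists_closed_turn hp hL hR hb hz hT hper
  obtain ⟨s', t', r', hs', ht', hr', hf'⟩ := exists_closed_turn hp hL hR hb hz' hT' hper'
  obtain ⟨hγL, hγR, hαL, hαR⟩ := id hp
  rw [abs_of_pos hL] at hγL
  rw [abs_of_neg hR] at hγR
  -- Both sides have the form `1 - 1 / γ ^ 2`, and `-γR < γL`.
  have hc : 4 * ((1 - p.γR) * (-1 - p.γR)) / (1 - p.γR + (-1 - p.γR)) ^ 2
      ≤ 4 * ((p.γL + 1) * (p.γL - 1)) / (p.γL + 1 + (p.γL - 1)) ^ 2 := by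
    have e1 : 4 * ((1 - p.γR) * (-1 - p.γR)) / (1 - p.γR + (-1 - p.γR)) ^ 2
        = 1 - 1 / (-p.γR) ^ 2 := by
      have := hR.ne
      rw [(by ring : 1 - p.γR + (-1 - p.γR) = 2 * -p.γR)]
      field_simp
      ring
    have e2 : 4 * ((p.γL + 1) * (p.γL - 1)) / (p.γL + 1 + (p.γL - 1)) ^ 2
        = 1 - 1 / p.γL ^ 2 := by
      rw [(by ring : p.γL + 1 + (p.γL - 1) = 2 * p.γL)]
      field_simp
      ring
    rw [e1, e2]
    have : 0 < -p.γR := by linarith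
    gcongr
    linarith
  have hne : ∀ {s₁ s₂ t₁ t₂ : ℝ}, 0 < s₁ → s₁ < s₂ → 0 < t₂ → _ → _ → False :=
    fun {s₁ s₂ t₁ t₂} => half_flights_not_lt (s₁ := s₁) (s₂ := s₂) (t₁ := t₁) (t₂ := t₂) hαL
      (by linarith : 0 < p.γL - 1) (by linarith : p.γL - 1 < p.γL + 1)
      (by linarith : 0 < -p.αR) (by linarith : 0 < -1 - p.γR)
      (by linarith : -1 - p.γR < 1 - p.γR) hc hb
  have hss : s = s' := by
    rcases lt_trichotomy s s' with hlt | heq | hlt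
    · exact (hne hs hlt ht' hf hf').elim
    · exact heq
    · exact (hne hs' hlt ht hf' hf).elim
  have hrr : z r = z' r' := by rw [hr, hr', hss]
  exact (hz.range_subset hz' hp hb hT hper hrr).antisymm
    (hz'.range_subset hz hp hb hT' hper' hrr.symm)

end NodeNode

theorem mainTheorem3 (p : NodeNode.Params) (hp : p.Admissible)
    (hL : 0 < p.γL) (hR : p.γR < 0) (hb : 0 < p.b) (hsum : 0 < p.γL + p.γR) :
    {Γ : Set (ℝ × ℝ) | NodeNode.IsLimitCycle p Γ}.encard ≤ 2 := by
  have h : {Γ : Set (ℝ × ℝ) | NodeNode.IsLimitCycle p Γ}.encard ≤ 1 :=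
    Set.encard_le_one_iff.2 fun _ _ h₁ h₂ =>
      NodeNode.crossingPeriodicOrbit_unique hp hL hR hb hsum h₁.1 h₂.1
  exact h.trans (by norm_num)
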